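/- All graphs are finite, undirected and simple. A single vertex counts as a cycle of length $1$ and a single edge (with its two ends) as a cycle of length $2$; all other cycles are cycles in the usual sense, and $|C|$ denotes the length of a cycle $C$. Let $C$ be a longest cycle of a graph $G$ with minimum degree $\delta$, and let $\overline{c}$ be the length of a longest cycle of $G-C$, the subgraph of $G$ induced by the vertices not on $C$ (with $\overline{c}=0$ if $C$ contains all vertices of $G$). Then $$|C|\geq(\overline{c}+1)(\delta-\overline{c}+1).$$ This bound is sharp: for all integers $1\leq\kappa\leq\delta$, the graph $(\kappa+1)K_{\delta-\kappa+1}+K_{\kappa}$, that is, the join of $\kappa+1$ disjoint copies of the complete graph on $\delta-\kappa+1$ vertices with the complete graph on $\kappa$ vertices, has minimum degree $\delta$ and has a longest cycle $C$ for which $\overline{c}=\delta-\kappa+1$ and $|C|=(\overline{c}+1)(\delta-\overline{c}+1)$. -/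

import Mathlib

/-- `IsCycleOfLength G C n`: the subgraph `C` of `G` is a cycle of length `n`, where a single vertex
counts as a cycle of length `1` and a single edge (with its two ends) as a cycle of length `2`. -/
inductive IsCycleOfLength {V : Type*} (G : SimpleGraph V) : G.Subgraph → ℕ → Prop
  | vertex (v : V) : IsCycleOfLength G (G.singletonSubgraph v) 1
  | edge {u v : V} (h : G.Adj u v) : IsCycleOfLength G (G.subgraphOfAdj h) 2
  | cycle {u : V} (p : G.Walk u u) (hp : p.IsCycle) : IsCycleOfLength G p.toSubgraph p.length

/-- `C` is a longest cycle of `G`, and its length is `n`. -/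
def IsLongestCycle {V : Type*} (G : SimpleGraph V) (C : G.Subgraph) (n : ℕ) : Prop :=
  IsCycleOfLength G C n ∧ ∀ (D : G.Subgraph) (m : ℕ), IsCycleOfLength G D m → m ≤ n

/-- The length of a longest cycle of a finite graph `G`; it is `0` for the graph without vertices,
which is the only finite graph without a cycle in the present sense. -/
noncomputable def circumference {V : Type*} (G : SimpleGraph V) : ℕ :=
  sSup {n : ℕ | ∃ C : G.Subgraph, IsCycleOfLength G C n}

/-- The graph `G - C`: the subgraph of `G` induced on the vertices outside `C`. -/
abbrev removeSubgraph {V : Type*} (G : SimpleGraph V) (C : G.Subgraph) :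
    SimpleGraph (↥(C.vertsᶜ)) :=
  G.induce C.vertsᶜ

/-- The graph `r K_m + K_k`: the join of `r` disjoint copies of the complete graph on `m` vertices
(the vertices `Sum.inl (i, a)`, where `i` is the number of the copy) with the complete graph on `k`
vertices (the vertices `Sum.inr b`). Two distinct vertices are adjacent unless they lie in two
different copies. -/
def joinGraph (r m k : ℕ) : SimpleGraph ((Fin r × Fin m) ⊕ Fin k) where
  Adj x y := x ≠ y ∧
    ∀ (i j : Fin r) (a b : Fin m), x = Sum.inl (i, a) → y = Sum.inl (j, b) → i = j
  symm := ⟨fun _ _ h => ⟨h.1.symm, fun i j a b hx hy => (h.2 j i b a hy hx).symm⟩⟩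
  loopless := ⟨fun _ h => h.1 rfl⟩

instance (r m k : ℕ) : DecidableRel (joinGraph r m k).Adj := fun x y =>
  inferInstanceAs (Decidable (x ≠ y ∧
    ∀ (i j : Fin r) (a b : Fin m), x = Sum.inl (i, a) → y = Sum.inl (j, b) → i = j))

/-! ### Cycles as lists and as injective cyclic sequences. -/

open SimpleGraph

/-! Write `n = |C|`, let `S` be the set of vertices outside `C`, and let `u` be a longest cycle of
`G - C`, of length `c`. For `c = 0` and `c = δ` the bound is Dirac's `n ≥ δ + 1`, and for `c > δ`
its right side is not positive. So let `0 < c < δ` and `N = δ - c + 1`.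

Suppose first that every `u k` has fewer than `c` neighbours in `S`. Then the set `Z k` of its
neighbours on `C` has at least `N` elements. Distinct points of `Z k` and `Z l`, `k ≠ l`, are joined
outside `C` by a path around `u` in either direction; since `C` is longest, their distance on `C` is
at least 2 plus the length of the longer arc of `u` between `u k` and `u l`. Hence a point lying in
`a` of the sets is followed by a gap of at least `a + 1` before the next point of the union `W`
(`ZMod.card_add_one_le_of_dist`). Summing the gaps gives `n ≥ ∑ |Z k| + |W| ≥ c N + N`
(`mul_le_of_dist`).

In general, `u k` is replaced by the end of a path in `S` starting at `u k`. The paths are disjoint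
and form a maximal system (`IsMaxLinkage`), so the neighbours in `S` of an end lie on `u` or on the
paths, and the detours only get longer. The end of a nontrivial path has fewer than `c` neighbours
in `S`, because `u` is longest (`IsMaxLinkage.card_nbrsIn_lt`). The ends with at least `c` of them
form an exceptional set `X` of trivial paths, with no two consecutive indices and with less than
half of all indices (`IsMaxLinkage.exists_exceptional`).

If no path is longer than `c / 2`, each end of a nontrivial path has at most `c / 2` neighbours in
`S`; this surplus pays for the excess on `X`, and the average of `|Z k|` is still at least `N`. If
`X` is nonempty and the path at some `u i` is longer than `c / 2`, the exceptional sets are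
discarded, and the great distance between `Z i` and the other sets makes up for the loss
(`mul_le_of_dist_of_far`).

For sharpness, a cycle of the join that is not inside one copy must pass through a new vertex of
`K_κ` each time it leaves a copy. A cycle alternating between all `κ` such vertices and `κ` whole
copies attains the resulting bound and leaves one copy over. -/

/-- The vertices `a, l₁, l₂, …` are distinct and form, in this order, a closed chain. -/
def ClosedChain {V : Type*} (G : SimpleGraph V) (a : V) (l : List V) : Prop :=
  (a :: l).Nodup ∧ (a :: (l ++ [a])).IsChain G.Adj

/-- Every closed chain inside `S` has at most `c` vertices. -/
def CycleBound {V : Type*} (G : SimpleGraph V) (S : Set V) (c : ℕ) : Prop :=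
  ∀ (a : V) (l : List V), ClosedChain G a l → (∀ v ∈ a :: l, v ∈ S) → l.length + 1 ≤ c

/-- The vertices `u 0, u 1, …` are distinct and form a cycle, in the sense in which vertices and
edges are cycles. -/
structure IsRing {V : Type*} (G : SimpleGraph V) {c : ℕ} (u : ZMod c → V) : Prop where
  inj : Function.Injective u
  adj : 2 ≤ c → ∀ i, G.Adj (u i) (u (i + 1))

theorem ClosedChain.exists_isCycleOfLength {V : Type*} {G : SimpleGraph V} {a : V} {l : List V}
    (h : ClosedChain G a l) :
    ∃ D : G.Subgraph, IsCycleOfLength G D (l.length + 1) ∧ D.verts = {v | v ∈ a :: l} := by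
  obtain ⟨hn, hc⟩ := h
  match l with
  -- With `l = []` the chain would need `a` adjacent to itself, so single vertices are not closed
  -- chains.
  | [] => simp at hc
  | [b] =>
    have hab : G.Adj a b := by simp at hc; exact hc.1
    refine ⟨_, .edge hab, ?_⟩
    ext v; simp
  | b :: d :: l =>
    have hne : (b :: d :: l) ++ [a] ≠ [] := by simp
    rw [List.isChain_cons] at hc
    obtain ⟨h1, h2⟩ := hc
    have hab : G.Adj a b := h1 b (by simp)
    set p := Walk.ofSupport _ hne h2 with hp
    have hs : p.support = (b :: d :: l) ++ [a] := Walk.support_ofSupport _ _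
    have hlast : ((b :: d :: l) ++ [a]).getLast hne = a := by simp
    have hhead : ((b :: d :: l) ++ [a]).head hne = b := by simp
    set q : G.Walk b a := p.copy hhead hlast with hq
    have hqs : q.support = (b :: d :: l) ++ [a] := by rw [hq, Walk.support_copy, hs]
    have hql : q.length = l.length + 2 := by
      have := q.length_support
      rw [hqs] at this; simp at this; omega
    have hqp : q.IsPath := by
      rw [Walk.isPath_def, hqs]
      have := (List.perm_append_singleton a (b :: d :: l)).nodup_iff.2 hn
      exact this
    have hcy : (Walk.cons hab q).IsCycle := by
      rw [Walk.isCycle_iff_isPath_tail_and_le_length]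
      exact ⟨by simpa using hqp, by simp [hql]⟩
    have hlen : (Walk.cons hab q).length = (b :: d :: l).length + 1 := by simp [hql]
    refine ⟨(Walk.cons hab q).toSubgraph, hlen ▸ IsCycleOfLength.cycle _ hcy, ?_⟩
    ext v
    rw [Walk.mem_verts_toSubgraph, Walk.support_cons, hqs]
    simp only [List.mem_cons, List.mem_append, List.not_mem_nil, Set.mem_ofPred_eq]
    tauto

theorem exists_isRing_of_list {V : Type*} {G : SimpleGraph V} {l : List V} {n : ℕ}
    (hlen : l.length = n) (hne : l ≠ [])
    (hn : l.Nodup) (hc : l.IsChain G.Adj)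
    (hlast : 2 ≤ l.length → G.Adj (l.getLast hne) (l.head hne)) :
    ∃ u : ZMod n → V, IsRing G u ∧ Set.range u = {v | v ∈ l} := by
  subst hlen
  have hpos : 0 < l.length := List.length_pos_iff.2 hne
  have : NeZero l.length := ⟨hpos.ne'⟩
  refine ⟨fun i => l[i.val]'(ZMod.val_lt i), ⟨?_, ?_⟩, ?_⟩
  · intro i j hij
    exact ZMod.val_injective _ ((hn.getElem_inj_iff).1 hij)
  · intro h2 i
    have hv : (i + 1).val = (i.val + 1) % l.length := by
      have : Fact (1 < l.length) := ⟨h2⟩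
      rw [ZMod.val_add, ZMod.val_one]
    have hi := ZMod.val_lt i
    rcases Nat.lt_or_ge (i.val + 1) l.length with h | h
    · have : (i + 1).val = i.val + 1 := by rw [hv, Nat.mod_eq_of_lt h]
      simp only [this]
      exact hc.getElem _ h
    · have e : i.val = l.length - 1 := by omega
      have : (i + 1).val = 0 := by rw [hv, show i.val + 1 = l.length by omega, Nat.mod_self]
      simp only [this, e]
      rw [List.getElem_zero, ← List.getLast_eq_getElem]
      exact hlast h2
  · ext v
    simp only [Set.mem_range, Set.mem_ofPred_eq, List.mem_iff_getElem]
    constructor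
    · rintro ⟨i, rfl⟩; exact ⟨_, ZMod.val_lt i, rfl⟩
    · rintro ⟨k, hk, rfl⟩
      exact ⟨(k : ZMod l.length), by simp [ZMod.val_natCast, Nat.mod_eq_of_lt hk]⟩

theorem IsCycleOfLength.exists_isRing {V : Type*} {G : SimpleGraph V} {C : G.Subgraph} {n : ℕ}
    (h : IsCycleOfLength G C n) :
    0 < n ∧ ∃ u : ZMod n → V, IsRing G u ∧ Set.range u = C.verts := by
  cases h with
  | vertex v =>
    refine ⟨one_pos, ?_⟩
    obtain ⟨u, hu, hr⟩ := exists_isRing_of_list (G := G) (l := [v]) rfl (by simp) (by simp) (by simp)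
      (by simp)
    exact ⟨u, hu, by rw [hr]; ext; simp⟩
  | @edge a b hab =>
    refine ⟨two_pos, ?_⟩
    obtain ⟨u, hu, hr⟩ := exists_isRing_of_list (G := G) (l := [a, b]) rfl (by simp)
      (by simpa using hab.ne) (by simpa using hab) (by simpa using hab.symm)
    exact ⟨u, hu, by rw [hr]; ext; simp⟩
  | @cycle a p hp =>
    refine ⟨by have := hp.three_le_length; omega, ?_⟩
    have hlen : p.support.tail.length = p.length := by simp
    have h3 := hp.three_le_length
    have hne : p.support.tail ≠ [] := by
      intro h; rw [h] at hlen; simp at hlen; omega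
    have hch := p.isChain_adj_support
    rw [← p.cons_tail_support, List.isChain_cons] at hch
    have hl : p.support.tail.getLast hne = a := by
      rw [List.getLast_tail, Walk.getLast_support]
    obtain ⟨u, hu, hr⟩ := exists_isRing_of_list (G := G) (l := p.support.tail) hlen hne
      hp.support_nodup hch.2 (by
        intro _; rw [hl]; exact hch.1 _ (by simp [List.head?_eq_some_head hne]))
    refine ⟨u, hu, ?_⟩
    rw [hr]
    ext v
    rw [Walk.mem_verts_toSubgraph, Set.mem_ofPred_eq, ← p.cons_tail_support, List.mem_cons]
    have ha : a ∈ p.support.tail := by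
      have := List.getLast_mem hne
      rwa [hl] at this
    exact ⟨Or.inr, fun h => h.elim (fun h => by rw [h]; exact ha) id⟩

theorem closedChain_iff {V : Type*} {G : SimpleGraph V} {a : V} {l : List V} :
    ClosedChain G a l ↔ (a :: l).Nodup ∧ (a :: l).IsChain G.Adj ∧
      G.Adj ((a :: l).getLast (by simp)) a := by
  rw [ClosedChain, ← List.cons_append, List.isChain_append]
  simp [List.getLast?_eq_some_getLast]

/-- Cut the list after the last of its entries that belongs to `T`. Applied to the neighbours of a
vertex on a path, this selects the farthest one. -/
theorem exists_prefix_of_forall_mem {V : Type*} (T : Finset V) (hT : T.Nonempty) (l : List V)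
    (h : ∀ t ∈ T, t ∈ l) :
    ∃ p b q, l = p ++ b :: q ∧ b ∈ T ∧ ∀ t ∈ T, t ∈ p ++ [b] := by
  induction l using List.reverseRecOn with
  | nil => obtain ⟨t, ht⟩ := hT; simpa using h t ht
  | append_singleton l b ih =>
    by_cases hb : b ∈ T
    · exact ⟨l, b, [], rfl, hb, h⟩
    · obtain ⟨p, b', q, rfl, hb', h'⟩ := ih (fun t ht => by
        have := h t ht
        simp only [List.mem_append, List.mem_singleton] at this
        exact this.resolve_right (fun e => hb (e ▸ ht)))
      exact ⟨p, b', q ++ [b], by simp, hb', h'⟩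

/-! ### Dirac's bound. -/

/-- If the first vertex of a path has `T` among its neighbours on the path, then the path contains
a cycle with at least `T.card + 1` vertices. -/
theorem CycleBound.card_add_one_le {V : Type*} {G : SimpleGraph V} {S : Set V} {c : ℕ}
    (hS : CycleBound G S c) {a : V} {l : List V} (hn : (a :: l).Nodup)
    (hc : (a :: l).IsChain G.Adj) (hl : ∀ v ∈ a :: l, v ∈ S) {T : Finset V} (hT : T.Nonempty)
    (h : ∀ t ∈ T, t ∈ l ∧ G.Adj a t) : T.card + 1 ≤ c := by
  classical
  obtain ⟨p, b, q, rfl, hb, hp⟩ := exists_prefix_of_forall_mem T hT l (fun t ht => (h t ht).1)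
  have hpre : a :: (p ++ [b]) <+: a :: (p ++ b :: q) := ⟨q, by simp⟩
  have hcc : ClosedChain G a (p ++ [b]) := by
    rw [closedChain_iff]
    refine ⟨hn.sublist hpre.sublist, hc.prefix hpre, ?_⟩
    simpa using (h b hb).2.symm
  have h1 := hS a _ hcc (fun v hv => hl v (hpre.subset hv))
  have h2 : T ⊆ (p ++ [b]).toFinset := fun t ht => List.mem_toFinset.2 (hp t ht)
  have h3 := (Finset.card_le_card h2).trans (List.toFinset_card_le _)
  omega

/-- Dirac: a graph of minimum degree at least `δ` has a cycle of length at least `δ + 1`. -/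
theorem CycleBound.minDegree_lt {V : Type*} [Fintype V] {G : SimpleGraph V} [DecidableRel G.Adj]
    [Nonempty V] {n : ℕ} (hn : 0 < n) (hG : CycleBound G Set.univ n) : G.minDegree + 1 ≤ n := by
  classical
  let P : ℕ → Prop := fun k => ∃ l : List V, l.Nodup ∧ l.IsChain G.Adj ∧ l.length = k
  have hbd : ∀ k, P k → k ≤ Fintype.card V := by
    rintro k ⟨l, hl, -, rfl⟩; exact hl.length_le_card
  have v₀ : V := Classical.arbitrary V
  have h1 : P 1 := ⟨[v₀], by simp, by simp, by simp⟩
  obtain ⟨l, hl, hc, hlen⟩ := Nat.findGreatest_spec (P := P) (hbd 1 h1) h1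
  have hmax : ∀ m : List V, m.Nodup → m.IsChain G.Adj → m.length ≤ l.length := by
    intro m hm hmc
    rw [hlen]
    exact Nat.le_findGreatest (hbd _ ⟨m, hm, hmc, rfl⟩) ⟨m, hm, hmc, rfl⟩
  match l with
  | [] => simpa using hmax [v₀] (by simp) (by simp)
  | a :: l =>
    -- A neighbour of the first vertex off the longest path could be prepended to it.
    have hnb : ∀ t ∈ G.neighborFinset a, t ∈ l ∧ G.Adj a t := by
      intro t ht
      rw [mem_neighborFinset] at ht
      refine ⟨?_, ht⟩
      by_contra htl
      have := hmax (t :: a :: l)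
        (List.nodup_cons.2 ⟨by simp [htl, ht.ne'], hl⟩)
        (List.isChain_cons.2 ⟨by simpa using ht.symm, hc⟩)
      simp at this
    have hdeg := G.minDegree_le_degree a
    rw [← card_neighborFinset_eq_degree] at hdeg
    rcases (G.neighborFinset a).eq_empty_or_nonempty with h | h
    · rw [h, Finset.card_empty] at hdeg; omega
    · have := hG.card_add_one_le hl hc (fun _ _ => trivial) h hnb
      omega

/-! ### Joining paths and arcs of a ring. -/

/-- `l` lists the inner vertices of a walk from `a` to `b`. -/
def Joins {V : Type*} (G : SimpleGraph V) (a : V) (l : List V) (b : V) : Prop :=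
  (a :: (l ++ [b])).IsChain G.Adj

theorem Joins.symm {V : Type*} {G : SimpleGraph V} {a b : V} {l : List V} (h : Joins G a l b) :
    Joins G b l.reverse a := by
  have h' : (a :: (l ++ [b])).reverse.IsChain G.Adj :=
    List.isChain_reverse.2 (List.IsChain.imp (fun _ _ h => h.symm) h)
  simpa [Joins] using h'

theorem Joins.trans {V : Type*} {G : SimpleGraph V} {a b d : V} {l m : List V}
    (h : Joins G a l b) (h' : Joins G b m d) : Joins G a (l ++ b :: m) d := by
  have := List.isChain_split (l₁ := a :: l) (c := b) (l₂ := m ++ [d]) |>.2 ⟨h, h'⟩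
  simpa [Joins] using this

/-- The vertices `u i, u (i + 1), …, u (i + m - 1)`. -/
def seg {V : Type*} {c : ℕ} (u : ZMod c → V) (i : ZMod c) (m : ℕ) : List V :=
  (List.range m).map fun k : ℕ => u (i + (k : ZMod c))

section seg
variable {V : Type*} {c : ℕ} (u : ZMod c → V) (i : ZMod c)

@[simp] theorem length_seg (m : ℕ) : (seg u i m).length = m := by simp [seg]

theorem seg_succ (m : ℕ) : seg u i (m + 1) = seg u i m ++ [u (i + (m : ZMod c))] := by
  simp [seg, List.range_succ]

theorem seg_add (m k : ℕ) : seg u i (m + k) = seg u i m ++ seg u (i + (m : ZMod c)) k := by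
  induction k with
  | zero => simp [seg]
  | succ k ih => rw [← add_assoc, seg_succ, ih, seg_succ]; simp [add_assoc]

theorem seg_succ' (m : ℕ) : seg u i (m + 1) = u i :: seg u (i + 1) m := by
  rw [add_comm, seg_add]; simp [seg]

theorem mem_range_of_mem_seg {m : ℕ} {v : V} (h : v ∈ seg u i m) : v ∈ Set.range u := by
  simp only [seg, List.mem_map] at h
  obtain ⟨k, -, rfl⟩ := h
  exact ⟨_, rfl⟩

variable {u}

theorem nodup_seg (hu : Function.Injective u) {m : ℕ} (hm : m ≤ c) : (seg u i m).Nodup := by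
  refine List.Nodup.map_on ?_ List.nodup_range
  intro a ha b hb h
  have h1 := add_left_cancel (hu h)
  rw [ZMod.natCast_eq_natCast_iff', Nat.mod_eq_of_lt, Nat.mod_eq_of_lt] at h1
  · exact h1
  · exact (List.mem_range.1 hb).trans_le hm
  · exact (List.mem_range.1 ha).trans_le hm

theorem isChain_seg {G : SimpleGraph V} (hu : IsRing G u) (hc : 2 ≤ c) (m : ℕ) :
    (seg u i m).IsChain G.Adj := by
  induction m with
  | zero => simp [seg]
  | succ m ih =>
    rw [seg_succ, List.isChain_append]
    refine ⟨ih, by simp, ?_⟩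
    rcases m with _ | m
    · simp [seg]
    · rw [seg_succ]
      intro x hx y hy
      simp at hx hy
      subst hx hy
      simpa [add_assoc] using hu.adj hc (i + (m : ZMod c))

end seg

theorem ZMod.val_sub_pos {c : ℕ} {i j : ZMod c} (hij : i ≠ j) : 0 < (j - i).val :=
  ZMod.val_pos.2 (sub_ne_zero.2 hij.symm)

theorem IsRing.neg {V : Type*} {G : SimpleGraph V} {c : ℕ} {u : ZMod c → V} (hu : IsRing G u) : IsRing G (fun i => u (-i)) where
  inj := hu.inj.comp neg_injective
  adj hc i := by
    have := hu.adj hc (-i - 1)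
    rw [sub_add_cancel] at this
    simpa [neg_add, sub_eq_add_neg, add_comm] using this.symm

/-! ### Exchange arguments on a longest cycle, used both for `C` in `G` and for `u` in `G - C`. -/

section ring
variable {V : Type*} {G : SimpleGraph V} {c : ℕ} [NeZero c] {u : ZMod c → V} {S : Set V}

theorem ZMod.val_sub_add_val_sub {i j : ZMod c} (hij : i ≠ j) :
    (j - i).val + (i - j).val = c := by
  have h : (i - j) = -(j - i) := by ring
  have : NeZero (j - i) := ⟨sub_ne_zero.2 hij.symm⟩
  have := ZMod.val_lt (j - i)
  rw [h, ZMod.val_neg_of_ne_zero]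
  omega

theorem two_le_of_ne {i j : ZMod c} (hij : i ≠ j) : 2 ≤ c := by
  have h1 := ZMod.val_sub_pos hij
  have h2 := ZMod.val_lt (j - i)
  omega

theorem ZMod.add_val_sub (i j : ZMod c) : i + (((j - i).val : ℕ) : ZMod c) = j := by simp

/-- A path that connects two vertices of a longest cycle outside the cycle is shorter than the
part of the cycle that it bypasses. -/
theorem IsRing.length_lt (hu : IsRing G u) (hS : CycleBound G S c) (huS : Set.range u ⊆ S)
    {i j : ZMod c} (hij : i ≠ j) {T : List V} (hT : Joins G (u i) T (u j)) (hn : T.Nodup)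
    (hTS : ∀ v ∈ T, v ∈ S) (hTu : ∀ v ∈ T, v ∉ Set.range u) :
    T.length + 1 ≤ (j - i).val := by
  have hc := two_le_of_ne hij
  have hpos := ZMod.val_sub_pos hij
  have hsum := ZMod.val_sub_add_val_sub hij
  set d := (j - i).val with hd
  set e := (i - j).val with he
  have hlast : u (j + (e : ZMod c)) = u i := by rw [he, ZMod.add_val_sub]
  -- Follow the ring from `u j` to `u i` and return along `T`: `e + 1 + T.length` vertices, at most
  -- `c = d + e`.
  have hcc : ClosedChain G (u j) (seg u (j + 1) e ++ T) := by
    constructor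
    · rw [← List.cons_append, ← seg_succ', List.nodup_append']
      refine ⟨nodup_seg _ hu.inj (by omega), hn, ?_⟩
      intro v hv hv'
      exact hTu v hv' (mem_range_of_mem_seg _ _ hv)
    · rw [List.append_assoc, ← List.cons_append, ← seg_succ', seg_succ, List.append_assoc,
        List.singleton_append, List.isChain_split, ← seg_succ, hlast]
      exact ⟨isChain_seg _ hu hc _, hT⟩
  have := hS _ _ hcc (by
    intro v hv
    rw [← List.cons_append, ← seg_succ', List.mem_append] at hv
    exact hv.elim (fun h => huS (mem_range_of_mem_seg _ _ h)) (hTS v))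
  simp at this
  omega

/-- If a vertex outside a longest cycle is adjacent to two vertices of the cycle, then the
successors of these are not adjacent. -/
theorem IsRing.not_adj_succ (hu : IsRing G u) (hS : CycleBound G S c) (huS : Set.range u ⊆ S)
    {i j : ZMod c} (hij : i ≠ j) {w : V} (hwS : w ∈ S) (hw : w ∉ Set.range u)
    (hi : G.Adj (u i) w) (hj : G.Adj (u j) w) : ¬ G.Adj (u (i + 1)) (u (j + 1)) := by
  intro hadj
  have hc := two_le_of_ne hij
  have hpos := ZMod.val_sub_pos hij
  have hpos' := ZMod.val_sub_pos hij.symm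
  have hsum := ZMod.val_sub_add_val_sub hij
  set d := (j - i).val with hd
  set e := (i - j).val with he
  obtain ⟨d', hd'⟩ : ∃ d', d = d' + 1 := ⟨d - 1, by omega⟩
  obtain ⟨e', he'⟩ : ∃ e', e = e' + 1 := ⟨e - 1, by omega⟩
  have hij' : i + 1 + (d : ZMod c) = j + 1 := by
    rw [add_right_comm, hd, ZMod.add_val_sub]
  have hj' : i + 1 + (d' : ZMod c) = j := by
    have : (d : ZMod c) = (d' : ZMod c) + 1 := by rw [hd']; push_cast; ring
    rw [this, ← add_assoc] at hij'
    exact add_right_cancel hij'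
  have hi' : j + 1 + (e' : ZMod c) = i := by
    have h1 : j + (e : ZMod c) = i := by rw [he, ZMod.add_val_sub]
    rw [he'] at h1; push_cast at h1
    rw [← h1]; ring
  have hnod : (seg u (i + 1) d ++ seg u (j + 1) e).Nodup := by
    rw [← hij', ← seg_add]; exact nodup_seg _ hu.inj hsum.le
  -- From `w` to `u j`, backwards to `u (i + 1)`, across to `u (j + 1)`, forwards to `u i` and back
  -- to `w`: all of the ring and `w`, so `c + 1` vertices.
  have hcc : ClosedChain G w ((seg u (i + 1) d).reverse ++ seg u (j + 1) e) := by
    rw [closedChain_iff]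
    refine ⟨?_, ?_, ?_⟩
    · rw [List.nodup_cons]
      constructor
      · intro h
        rw [List.mem_append, List.mem_reverse] at h
        exact hw (h.elim (mem_range_of_mem_seg _ _) (mem_range_of_mem_seg _ _))
      · exact (((List.reverse_perm _).append_right _).nodup_iff).2 hnod
    · rw [List.isChain_cons, List.isChain_append]
      refine ⟨?_, ?_, isChain_seg _ hu hc _, ?_⟩
      · rw [hd', seg_succ, hj']
        simpa using hj.symm
      · rw [List.isChain_reverse]
        exact (isChain_seg _ hu hc _).imp (fun _ _ h => h.symm)
      · rw [hd', he', seg_succ', seg_succ']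
        simpa using hadj
    · have : (w :: ((seg u (i + 1) d).reverse ++ seg u (j + 1) e)).getLast (by simp) = u i := by
        simp [he', seg_succ, hi']
      rw [this]; exact hi
  have := hS _ _ hcc (by
    intro v hv
    rw [List.mem_cons, List.mem_append, List.mem_reverse] at hv
    rcases hv with rfl | h | h
    · exact hwS
    · exact huS (mem_range_of_mem_seg _ _ h)
    · exact huS (mem_range_of_mem_seg _ _ h))
  simp at this
  omega

theorem IsRing.not_adj_pred (hu : IsRing G u) (hS : CycleBound G S c) (huS : Set.range u ⊆ S)
    {i j : ZMod c} (hij : i ≠ j) {w : V} (hwS : w ∈ S) (hw : w ∉ Set.range u)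
    (hi : G.Adj (u i) w) (hj : G.Adj (u j) w) : ¬ G.Adj (u (i - 1)) (u (j - 1)) := by
  have hr : Set.range (fun i => u (-i)) = Set.range u := neg_surjective.range_comp u
  have := hu.neg.not_adj_succ hS (hr ▸ huS) (i := -i) (j := -j) (fun h => hij (neg_injective h))
    hwS (hr ▸ hw) (by simpa using hi) (by simpa using hj)
  simpa [neg_add, sub_eq_add_neg, add_comm] using this

end ring

/-! ### Distances and gaps on a cycle of indices. -/

open Finset

/-- Intervals of a cycle around different points that do not overlap have total length at most the
length of the cycle. -/
theorem ZMod.sum_radii_le {n : ℕ} [NeZero n] {W : Finset (ZMod n)} (hW : W.Nontrivial)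
    (a b : ZMod n → ℕ)
    (h : ∀ w ∈ W, ∀ w' ∈ W, w ≠ w' → a w + b w' ≤ (w' - w).val) :
    ∑ w ∈ W, (a w + b w) ≤ n := by
  have hle : ∀ w ∈ W, a w + b w ≤ n := by
    intro w hw
    obtain ⟨w', hw', hne⟩ := hW.exists_ne w
    have h1 := h w hw w' hw' hne.symm
    have h2 := h w' hw' w hw hne
    have := ZMod.val_sub_add_val_sub hne
    omega
  have key : (W.sigma fun w => range (a w + b w)).card ≤ (univ : Finset (ZMod n)).card := by
    -- The interval around `w` consists of the points from `w - b w` to `w + a w - 1`; the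
    -- hypothesis makes these intervals disjoint.
    refine Finset.card_le_card_of_injOn
      (fun x => x.1 - ((b x.1 : ℕ) : ZMod n) + ((x.2 : ℕ) : ZMod n)) (by simp) ?_
    rintro ⟨w, k⟩ hx ⟨w', k'⟩ hx' heq
    simp only [coe_sigma, Set.mem_sigma_iff, mem_coe, mem_range] at hx hx'
    obtain ⟨hw, hk⟩ := hx
    obtain ⟨hw', hk'⟩ := hx'
    simp only at heq
    by_cases hne : w = w'
    · subst hne
      have h1 := add_left_cancel heq
      have h2 := hle w hw
      rw [ZMod.natCast_eq_natCast_iff', Nat.mod_eq_of_lt (by omega),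
        Nat.mod_eq_of_lt (by omega)] at h1
      rw [h1]
    · exfalso
      have h1 := h w hw w' hw' hne
      have h2 := h w' hw' w hw (Ne.symm hne)
      have h3 := ZMod.val_sub_add_val_sub hne
      have h4 : w + (((w' - w).val : ℕ) : ZMod n) = w' := ZMod.add_val_sub w w'
      set d := (w' - w).val
      set e := (w - w').val
      -- A coincidence makes this integer divisible by `n`, while the distance conditions place it
      -- strictly between `-n` and `0`.
      have h5 : (((k : ℤ) - b w - k' + b w' - d : ℤ) : ZMod n) = 0 := by
        push_cast
        linear_combination heq - h4
      rw [ZMod.intCast_zmod_eq_zero_iff_dvd] at h5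
      obtain ⟨t, ht⟩ := h5
      have hn : (0 : ℤ) < n := by have := NeZero.pos n; exact_mod_cast this
      have l1 : (n : ℤ) * t < 0 := by rw [← ht]; omega
      have l2 : -(n : ℤ) < n * t := by rw [← ht]; omega
      have l3 : t < 0 := by nlinarith
      nlinarith
  rwa [card_sigma, card_univ, ZMod.card, sum_congr rfl (fun w _ => card_range _)] at key

/-- Take for `g w` the distance from `w` forwards to the next point of `W`; the intervals in between
are disjoint. -/
theorem ZMod.exists_gap {n : ℕ} [NeZero n] {W : Finset (ZMod n)} (hW : W.Nontrivial) :
    ∃ g : ZMod n → ℕ, (∀ w ∈ W, ∃ w' ∈ W, w ≠ w' ∧ (w' - w).val = g w) ∧ ∑ w ∈ W, g w ≤ n := by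
  have h : ∀ w ∈ W, ∃ w' ∈ W.erase w, ∀ v ∈ W.erase w, (w' - w).val ≤ (v - w).val := by
    intro w hw
    refine exists_min_image _ _ ?_
    obtain ⟨w', hw', hne⟩ := hW.exists_ne w
    exact ⟨w', mem_erase.2 ⟨hne, hw'⟩⟩
  choose! f hf hmin using h
  refine ⟨fun w => (f w - w).val, ?_, ?_⟩
  · intro w hw
    have := mem_erase.1 (hf w hw)
    exact ⟨f w, this.2, this.1.symm, rfl⟩
  · refine ZMod.sum_radii_le hW _ (fun _ => 0) ?_
    intro w hw w' hw' hne
    exact hmin w hw w' (mem_erase.2 ⟨hne.symm, hw'⟩)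

/-- A set of points of a cycle of length `c`, all of them at distance less than `D - 1` in both
directions from a given point `b`, has at most `D - 1` elements. -/
theorem ZMod.card_add_one_le_of_dist {c : ℕ} [NeZero c] {A : Finset (ZMod c)} {b : ZMod c} {D : ℕ}
    (hA : (A.erase b).Nonempty)
    (h : ∀ a ∈ A, a ≠ b → (a - b).val + 2 ≤ D ∧ (b - a).val + 2 ≤ D) : A.card + 1 ≤ D := by
  -- The two distances add up to `c`. So `A.card - 1 ≤ 2 * D - 3 - c`, and adding `A.card ≤ c` gives
  -- the claim.
  have hsum : ∀ a ∈ A.erase b, (a - b).val ∈ Icc (c + 2 - D) (D - 2) := by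
    intro a ha
    obtain ⟨hne, ha⟩ := mem_erase.1 ha
    have := h a ha hne
    have h3 := ZMod.val_sub_add_val_sub hne
    rw [mem_Icc]; omega
  have hinj : Set.InjOn (fun a : ZMod c => (a - b).val) (A.erase b) := by
    intro x _ y _ hxy
    exact sub_left_injective (ZMod.val_injective _ hxy)
  have hcard := card_le_card_of_injOn _ hsum hinj
  rw [Nat.card_Icc] at hcard
  have h1 := pred_card_le_card_erase (s := A) (a := b)
  have h2 := hA.card_pos
  have h3 : A.card ≤ c := by simpa using card_le_univ A
  omega

/-- `X` and its translate by 1 are disjoint subsets of `T`. -/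
theorem ZMod.two_mul_card_le_of_succ_notMem {c : ℕ} [NeZero c] {X T : Finset (ZMod c)}
    (hX : ∀ x ∈ X, x + 1 ∉ X) (hXT : X ⊆ T) (hXT' : X.map (addRightEmbedding 1) ⊆ T) :
    2 * X.card ≤ T.card := by
  have hd : Disjoint X (X.map (addRightEmbedding 1)) := by
    rw [Finset.disjoint_left]
    intro x hx hx'
    simp only [mem_map, addRightEmbedding_apply] at hx'
    obtain ⟨y, hy, rfl⟩ := hx'
    exact hX y hy hx
  have := card_le_card (union_subset hXT hXT')
  rw [card_union_of_disjoint hd, card_map] at this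
  omega

/-- A variant of `ZMod.card_add_one_le_of_dist` for sets that avoid a given set `X` of pairwise
non-consecutive points and one more point `i`. -/
theorem ZMod.mul_card_le_of_dist {c : ℕ} [NeZero c] {A X : Finset (ZMod c)} {b i : ZMod c} {D : ℕ}
    (hX : ∀ x ∈ X, x + 1 ∉ X) (hi : i ∉ X) (hA : (A.erase b).Nonempty)
    (hAX : Disjoint A X) (hAi : i ∉ A)
    (h : ∀ a ∈ A, a ≠ b → (a - b).val + 2 ≤ D ∧ (b - a).val + 2 ≤ D) :
    (c - 1) * A.card ≤ (c - X.card - 1) * D := by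
  classical
  have hcomp : (insert i X)ᶜ.card = c - X.card - 1 := by
    rw [card_compl, card_insert_of_notMem hi, ZMod.card]; omega
  have hsub : A ⊆ (insert i X)ᶜ := by
    intro a ha
    rw [mem_compl, mem_insert]
    rintro (rfl | h)
    · exact hAi ha
    · exact disjoint_left.1 hAX ha h
  have hAκ := card_le_card hsub
  rw [hcomp] at hAκ
  have hpos : 0 < c := NeZero.pos c
  -- For large `D`, it is enough that `A` avoids `X` and `i`.
  by_cases hD : c ≤ D + 1
  · calc (c - 1) * A.card ≤ D * (c - X.card - 1) := Nat.mul_le_mul (by omega) hAκ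
      _ = _ := mul_comm _ _
  -- the points at distance at most `t` from `b`
  obtain ⟨t, ht⟩ : ∃ t, t + D = c + 1 := ⟨c + 1 - D, by omega⟩
  have hsum : ∀ a ∈ A, a ≠ b → t + 1 ≤ (a - b).val ∧ (a - b).val + t + 1 ≤ c := by
    intro a ha hne
    have := h a ha hne
    have h3 := ZMod.val_sub_add_val_sub hne
    omega
  obtain ⟨a₀, ha₀⟩ := hA
  obtain ⟨hne₀, ha₀⟩ := mem_erase.1 ha₀
  have htc := hsum a₀ ha₀ hne₀
  let B : ℕ → Finset (ZMod c) := fun m => (range m).image fun k : ℕ => b - (t : ZMod c) + (k : ZMod c)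
  have hBinj : ∀ m ≤ c, (B m).card = m := by
    intro m hm
    rw [card_image_of_injOn, card_range]
    intro x hx y hy hxy
    have h1 := add_left_cancel hxy
    rw [mem_coe, mem_range] at hx hy
    rwa [ZMod.natCast_eq_natCast_iff', Nat.mod_eq_of_lt (by omega),
        Nat.mod_eq_of_lt (by omega)] at h1
  have hB1 : (B (2 * t + 1)).card = 2 * t + 1 := hBinj _ (by omega)
  have hB2 : (B (2 * t + 2)).card ≤ 2 * t + 2 := card_image_le.trans (card_range _).le
  -- Having no consecutive points, `X` takes up at most `t + 1` of the `2 * t + 1` points of the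
  -- interval around `b`.
  have hXB : 2 * (X ∩ B (2 * t + 1)).card ≤ 2 * t + 2 := by
    refine (ZMod.two_mul_card_le_of_succ_notMem (T := B (2 * t + 2)) ?_ ?_ ?_).trans hB2
    · intro x hx hx'
      exact hX x (mem_inter.1 hx).1 (mem_inter.1 hx').1
    · exact inter_subset_right.trans (image_subset_image (range_mono (by omega)))
    · intro x hx
      simp only [mem_map, addRightEmbedding_apply] at hx
      obtain ⟨y, hy, rfl⟩ := hx
      obtain ⟨k, hk, rfl⟩ := mem_image.1 (mem_inter.1 hy).2
      rw [mem_range] at hk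
      exact mem_image.2 ⟨k + 1, mem_range.2 (by omega), by push_cast; ring⟩
  have hAB : Disjoint A (B (2 * t + 1) \ insert b (insert i (X ∩ B (2 * t + 1)))) := by
    rw [Finset.disjoint_left]
    intro a ha haB
    rw [mem_sdiff, mem_insert] at haB
    push Not at haB
    obtain ⟨haB, hab, -⟩ := haB
    obtain ⟨k, hk, hka⟩ := mem_image.1 haB
    rw [mem_range] at hk
    have h1 := hsum a ha hab
    rcases Nat.lt_or_ge k t with hkt | hkt
    · have : (b - a).val = t - k := by
        have e : b - a = ((t - k : ℕ) : ZMod c) := by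
          rw [← hka, Nat.cast_sub hkt.le]; ring
        rw [e, ZMod.val_natCast, Nat.mod_eq_of_lt (by omega)]
      have h3 := ZMod.val_sub_add_val_sub hab
      omega
    · have : (a - b).val = k - t := by
        have e : a - b = ((k - t : ℕ) : ZMod c) := by
          rw [← hka, Nat.cast_sub hkt]; ring
        rw [e, ZMod.val_natCast, Nat.mod_eq_of_lt (by omega)]
      omega
  have hsub2 : A ∪ (B (2 * t + 1) \ insert b (insert i (X ∩ B (2 * t + 1)))) ⊆ (insert i X)ᶜ := by
    refine union_subset hsub ?_
    intro a ha
    simp only [mem_sdiff, mem_insert, mem_inter, mem_compl] at ha ⊢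
    tauto
  have h1 := card_le_card hsub2
  rw [card_union_of_disjoint hAB, hcomp] at h1
  have h2 := le_card_sdiff (insert b (insert i (X ∩ B (2 * t + 1)))) (B (2 * t + 1))
  have h3 := card_insert_le b (insert i (X ∩ B (2 * t + 1)))
  have h4 := card_insert_le i (X ∩ B (2 * t + 1))
  -- Apart from `b`, the set `A` misses the interval, which has at least `t - 2` points other than
  -- `b`, `i` and those of `X`. With `s = t - 2` and `κ ≤ c - 1` the claim follows from `A.card ≤ κ
  -- - s` and `D = c - 1 - s`.
  have h5 : A.card + t ≤ c - X.card - 1 + 2 := by omega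
  set κ := c - X.card - 1
  have hκ : κ ≤ c - 1 := by omega
  obtain ⟨s, rfl⟩ : ∃ s, t = s + 2 := ⟨t - 2, by omega⟩
  obtain ⟨r, hr⟩ : ∃ r, c - 1 = κ + r := ⟨c - 1 - κ, by omega⟩
  have hDs : D + s = c - 1 := by omega
  rw [hr] at hDs ⊢
  have h6 : A.card + s ≤ κ := by omega
  have h7 : (κ + r) * (A.card + s) ≤ (κ + r) * κ := Nat.mul_le_mul_left _ h6
  have h8 : κ * (D + s) = κ * (κ + r) := by rw [hDs]
  nlinarith [Nat.zero_le (r * s)]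

/-! ### Double counting of the attachment points on `C`. -/

section counting
variable {n c : ℕ} [NeZero c] (Z : ZMod c → Finset (ZMod n))

/-- The indices of the sets among the `Z k` that contain `p`. -/
def indices (p : ZMod n) : Finset (ZMod c) := univ.filter fun k => p ∈ Z k

variable {Z}

@[simp] theorem mem_indices {p : ZMod n} {k : ZMod c} : k ∈ indices Z p ↔ p ∈ Z k := by
  simp [indices]

variable [NeZero n]

/-- If all points of `Z k` are far away from the points of `Z l` for `l ≠ k`, then the sets `Z k`
cannot be large. -/
theorem mul_le_of_dist {N : ℕ} (hN : 2 ≤ N) {k₀ : ZMod c} (hk₀ : N ≤ (Z k₀).card)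
    (hsum : c * N ≤ ∑ k, (Z k).card)
    (h2 : ∀ k l, ∀ p ∈ Z k, ∀ p' ∈ Z l, p ≠ p' → 2 ≤ (p' - p).val)
    (hd : ∀ k l, k ≠ l → ∀ p ∈ Z k, ∀ p' ∈ Z l, p ≠ p' →
      (k - l).val + 2 ≤ (p' - p).val ∧ (l - k).val + 2 ≤ (p' - p).val) :
    (c + 1) * N ≤ n := by
  classical
  set W := univ.biUnion Z with hW
  have hZW : ∀ k, Z k ⊆ W := fun k => subset_biUnion_of_mem Z (mem_univ k)
  have hNW : N ≤ W.card := hk₀.trans (card_le_card (hZW k₀))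
  have hWn : W.Nontrivial := one_lt_card_iff_nontrivial.1 (by omega)
  obtain ⟨g, hg, hgn⟩ := ZMod.exists_gap hWn
  have hgA : ∀ w ∈ W, (indices Z w).card + 1 ≤ g w := by
    intro w hw
    obtain ⟨w', hw', hne, hgw⟩ := hg w hw
    rw [← hgw]
    obtain ⟨l, -, hl⟩ := mem_biUnion.1 hw'
    -- If `w` lies in no set other than possibly `Z l`, its gap only has to be at least 2.
    rcases ((indices Z w).erase l).eq_empty_or_nonempty with he | he
    · obtain ⟨k, -, hk⟩ := mem_biUnion.1 hw
      have h1 := h2 k l w hk w' hl hne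
      have h3 := pred_card_le_card_erase (s := indices Z w) (a := l)
      rw [he, card_empty] at h3
      omega
    · refine ZMod.card_add_one_le_of_dist he ?_
      intro a ha hal
      exact hd a l hal w (mem_indices.1 ha) w' hl hne
  have hcount : ∑ w ∈ W, (indices Z w).card = ∑ k, (Z k).card := by
    have := sum_card_bipartiteAbove_eq_sum_card_bipartiteBelow (s := W) (t := univ)
      (fun w k => w ∈ Z k)
    refine this.trans (sum_congr rfl fun k _ => ?_)
    congr 1
    ext p
    simp only [mem_bipartiteBelow]
    exact ⟨fun h => h.2, fun h => ⟨hZW k h, h⟩⟩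
  have h3 : ∑ w ∈ W, ((indices Z w).card + 1) ≤ ∑ w ∈ W, g w := sum_le_sum hgA
  rw [sum_add_distrib, hcount, sum_const, smul_eq_mul, mul_one] at h3
  nlinarith

/-- A variant of `mul_le_of_dist`: some of the sets `Z k` may be small if their indices are pairwise
non-consecutive, provided that the points of one of the other sets are very far away from the points
of the sets different from it. -/
theorem mul_le_of_dist_of_far (hc : 2 ≤ c) {N : ℕ} (hN : 2 ≤ N) {X : Finset (ZMod c)}
    (hX : ∀ k ∈ X, k + 1 ∉ X) (hXc : 2 * X.card < c) (hZX : ∀ k ∈ X, Z k = ∅)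
    (hZN : ∀ k ∉ X, N ≤ (Z k).card) {i : ZMod c} (hi : i ∉ X)
    (h2 : ∀ k l, ∀ p ∈ Z k, ∀ p' ∈ Z l, p ≠ p' → 2 ≤ (p' - p).val)
    (hd : ∀ k l, k ≠ l → ∀ p ∈ Z k, ∀ p' ∈ Z l, p ≠ p' →
      (k - l).val + 2 ≤ (p' - p).val ∧ (l - k).val + 2 ≤ (p' - p).val)
    (hfar : ∀ k l, k ≠ l → k = i ∨ l = i → ∀ p ∈ Z k, ∀ p' ∈ Z l, p ≠ p' →
      c + 1 ≤ (p' - p).val) :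
    (c + 1) * N ≤ n := by
  classical
  set W := univ.biUnion Z with hW
  have hZW : ∀ k, Z k ⊆ W := fun k => subset_biUnion_of_mem Z (mem_univ k)
  have hNW : N ≤ W.card := (hZN i hi).trans (card_le_card (hZW i))
  have hWn : W.Nontrivial := one_lt_card_iff_nontrivial.1 (by omega)
  obtain ⟨g, hg, hgn⟩ := ZMod.exists_gap hWn
  set κ := c - X.card - 1 with hκ
  have hAX : ∀ w, Disjoint (indices Z w) X := by
    intro w
    rw [Finset.disjoint_left]
    intro k hk hkX
    rw [mem_indices, hZX k hkX] at hk
    simp at hk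
  have hg2 : ∀ w ∈ W, 2 ≤ g w := by
    intro w hw
    obtain ⟨w', hw', hne, hgw⟩ := hg w hw
    obtain ⟨l, -, hl⟩ := mem_biUnion.1 hw'
    obtain ⟨k, -, hk⟩ := mem_biUnion.1 hw
    exact hgw ▸ h2 k l w hk w' hl hne
  have hgR : ∀ w ∈ Z i, (∃ k ≠ i, w ∈ Z k) → c + 1 ≤ g w := by
    rintro w hw ⟨k, hki, hk⟩
    obtain ⟨w', hw', hne, hgw⟩ := hg w (hZW i hw)
    obtain ⟨l, -, hl⟩ := mem_biUnion.1 hw'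
    rw [← hgw]
    by_cases hli : l = i
    · exact hfar k l (hli ▸ hki) (Or.inr hli) w hk w' hl hne
    · exact hfar i l (Ne.symm hli) (Or.inl rfl) w hw w' hl hne
  have hgO : ∀ w ∈ W, w ∉ Z i → (c - 1) * (indices Z w).card ≤ κ * g w := by
    intro w hw hwi
    obtain ⟨w', hw', hne, hgw⟩ := hg w hw
    obtain ⟨l, -, hl⟩ := mem_biUnion.1 hw'
    rw [← hgw]
    have hiA : i ∉ indices Z w := by rwa [mem_indices]
    rcases ((indices Z w).erase l).eq_empty_or_nonempty with he | he
    · obtain ⟨k, -, hk⟩ := mem_biUnion.1 hw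
      have h1 := h2 k l w hk w' hl hne
      have h3 := pred_card_le_card_erase (s := indices Z w) (a := l)
      rw [he, card_empty] at h3
      -- Here `2 * X.card < c` enters, as `c - 1 ≤ 2 * κ`.
      calc (c - 1) * (indices Z w).card ≤ (2 * κ) * 1 := Nat.mul_le_mul (by omega) (by omega)
        _ = κ * 2 := by ring
        _ ≤ _ := Nat.mul_le_mul_left _ h1
    · refine ZMod.mul_card_le_of_dist hX hi he (hAX w) hiA ?_
      intro a ha hal
      exact hd a l hal w (mem_indices.1 ha) w' hl hne
  have hκpos : 0 < κ := by
    omega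
  -- The gaps contribute at least `c + 1` for each point of `R`, 2 for each point of `P`, and `(c -
  -- 1) * (N - R.card)` in total on `O`. Since `P.card ≥ N - R.card`, the sum is at least `(c + 1) *
  -- N`.
  set R := (Z i).filter fun w => ∃ k ≠ i, w ∈ Z k with hR
  set P := (Z i).filter fun w => ¬ ∃ k ≠ i, w ∈ Z k with hP
  set O := W.filter fun w => w ∉ Z i with hO
  have hPR : R.card + P.card = (Z i).card := card_filter_add_card_filter_not _
  have hsplit : ∑ w ∈ W, g w = ∑ w ∈ R, g w + ∑ w ∈ P, g w + ∑ w ∈ O, g w := by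
    rw [hR, hP, sum_filter_add_sum_filter_not, hO, ← sum_filter_add_sum_filter_not W (· ∈ Z i)]
    congr 2
    ext p
    simp only [mem_filter]
    exact ⟨fun h => h.2, fun h => ⟨hZW i h, h⟩⟩
  have hsR : R.card * (c + 1) ≤ ∑ w ∈ R, g w := by
    rw [← smul_eq_mul]
    refine card_nsmul_le_sum _ _ _ fun w hw => ?_
    exact hgR w (mem_filter.1 hw).1 (mem_filter.1 hw).2
  have hsP : P.card * 2 ≤ ∑ w ∈ P, g w := by
    rw [← smul_eq_mul]
    refine card_nsmul_le_sum _ _ _ fun w hw => ?_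
    exact hg2 w (hZW i (mem_filter.1 hw).1)
  have hsO : (c - 1) * ∑ w ∈ O, (indices Z w).card ≤ κ * ∑ w ∈ O, g w := by
    rw [mul_sum, mul_sum]
    exact sum_le_sum fun w hw => hgO w (mem_filter.1 hw).1 (mem_filter.1 hw).2
  have hcount : ∑ w ∈ O, (indices Z w).card = ∑ k, (Z k \ Z i).card := by
    have := sum_card_bipartiteAbove_eq_sum_card_bipartiteBelow (s := O) (t := univ)
      (fun w k => w ∈ Z k)
    refine this.trans (sum_congr rfl fun k _ => ?_)
    congr 1
    ext p
    simp only [mem_bipartiteBelow, mem_sdiff, hO, mem_filter]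
    exact ⟨fun h => ⟨h.2, h.1.2⟩, fun h => ⟨⟨hZW k h.1, h.2⟩, h.1⟩⟩
  -- There are `κ` indices outside `X` other than `i`, and for each of them `Z k` meets `Z i` only
  -- inside `R`.
  have hlow : κ * (N - R.card) ≤ ∑ k, (Z k \ Z i).card := by
    have h1 : κ = (insert i X)ᶜ.card := by
      rw [card_compl, card_insert_of_notMem hi, ZMod.card]; omega
    rw [h1, ← smul_eq_mul]
    refine (card_nsmul_le_sum _ (fun k => (Z k \ Z i).card) _ fun k hk => ?_).trans
      (sum_le_sum_of_subset (subset_univ _))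
    rw [mem_compl, mem_insert, not_or] at hk
    have h3 : Z k ∩ Z i ⊆ R := by
      intro p hp
      rw [mem_inter] at hp
      exact mem_filter.2 ⟨hp.2, k, hk.1, hp.1⟩
    have h4 := card_le_card h3
    have h5 := card_sdiff_add_card_inter (Z k) (Z i)
    have h6 := hZN k hk.2
    show N - R.card ≤ (Z k \ Z i).card
    omega
  have hO2 : (c - 1) * (N - R.card) ≤ ∑ w ∈ O, g w := by
    refine Nat.le_of_mul_le_mul_left ?_ hκpos
    calc κ * ((c - 1) * (N - R.card)) = (c - 1) * (κ * (N - R.card)) := by ring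
      _ ≤ (c - 1) * ∑ k, (Z k \ Z i).card := Nat.mul_le_mul_left _ hlow
      _ ≤ _ := hcount ▸ hsO
  have hiN := hZN i hi
  have hcpos : 0 < c := NeZero.pos c
  rcases Nat.lt_or_ge R.card N with hlt | hge
  · obtain ⟨y, hy⟩ : ∃ y, N = R.card + y := ⟨N - R.card, by omega⟩
    obtain ⟨e, he⟩ : ∃ e, c = e + 1 := ⟨c - 1, by omega⟩
    rw [show N - R.card = y by omega, show c - 1 = e by omega] at hO2
    rw [he] at hsR ⊢
    rw [hy]
    nlinarith
  · nlinarith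
end counting

/-! ### Linkages and their maximality. -/

/-- `Q` is a family of disjoint paths in `S` that start at the vertices `u i` of a ring and do not
meet the ring otherwise; `Q i` lists the vertices of the path at `u i` after `u i`. -/
structure IsLinkage {V : Type*} (G : SimpleGraph V) (S : Set V) {c : ℕ} (u : ZMod c → V)
    (Q : ZMod c → List V) : Prop where
  chain : ∀ i, (u i :: Q i).IsChain G.Adj
  nodup : ∀ i, (Q i).Nodup
  disjoint : ∀ i j, i ≠ j → (Q i).Disjoint (Q j)
  notMem : ∀ i, ∀ v ∈ Q i, v ∉ Set.range u
  mem : ∀ i, ∀ v ∈ Q i, v ∈ S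

/-- The last vertex of the path at `u i`. -/
def linkEnd {V : Type*} {c : ℕ} (u : ZMod c → V) (Q : ZMod c → List V) (i : ZMod c) : V :=
  (u i :: Q i).getLast (by simp)

/-- A linkage that can neither be extended at the end of a path nor be rearranged so that more of
its paths are nontrivial. -/
structure IsMaxLinkage {V : Type*} (G : SimpleGraph V) (S : Set V) {c : ℕ} (u : ZMod c → V)
    (Q : ZMod c → List V) : Prop extends IsLinkage G S u Q where
  closed : ∀ i, ∀ z ∈ S, G.Adj (linkEnd u Q i) z → z ∈ Set.range u ∨ ∃ j, z ∈ Q j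
  head : ∀ i, Q i = [] → ∀ z, G.Adj (u i) z → ∀ j, z ∈ Q j → (Q j).head? = some z

section linkage
variable {V : Type*} {G : SimpleGraph V} {S : Set V} {c : ℕ} {u : ZMod c → V}
  {Q : ZMod c → List V}

theorem joins_iff {a b : V} {l : List V} :
    Joins G a l b ↔ (a :: l).IsChain G.Adj ∧ G.Adj ((a :: l).getLast (by simp)) b := by
  rw [Joins, ← List.cons_append, List.isChain_append]
  simp [List.getLast?_eq_some_getLast]

theorem IsLinkage.sum_length_le [Fintype V] [NeZero c] (h : IsLinkage G S u Q) :
    ∑ i, (Q i).length ≤ Fintype.card V := by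
  classical
  have h1 : ∑ i, (Q i).length = ∑ i, (Q i).toFinset.card :=
    sum_congr rfl fun i _ => (List.toFinset_card_of_nodup (h.nodup i)).symm
  rw [h1, ← card_biUnion]
  · exact card_le_univ _
  · intro i _ j _ hij
    exact List.disjoint_toFinset_iff_disjoint.2 (h.disjoint i j hij)

theorem IsLinkage.update_append (h : IsLinkage G S u Q) {i : ZMod c} {z : V} (hz : z ∈ S)
    (hadj : G.Adj (linkEnd u Q i) z) (hzu : z ∉ Set.range u) (hzQ : ∀ j, z ∉ Q j) :
    IsLinkage G S u (Function.update Q i (Q i ++ [z])) := by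
  have hmem : ∀ j v, v ∈ Function.update Q i (Q i ++ [z]) j → v ∈ Q j ∨ v = z := by
    intro j v hv
    by_cases hj : j = i
    · subst hj; simpa using hv
    · rw [Function.update_of_ne hj] at hv; exact Or.inl hv
  refine ⟨?_, ?_, ?_, ?_, ?_⟩
  · intro j
    by_cases hj : j = i
    · subst hj
      rw [Function.update_self]
      exact joins_iff.2 ⟨h.chain j, hadj⟩
    · rw [Function.update_of_ne hj]; exact h.chain j
  · intro j
    by_cases hj : j = i
    · subst hj
      rw [Function.update_self, List.nodup_append']
      exact ⟨h.nodup j, by simp, by simpa using hzQ j⟩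
    · rw [Function.update_of_ne hj]; exact h.nodup j
  · intro j k hjk v hv hv'
    rcases hmem j v hv with h1 | rfl
    · rcases hmem k v hv' with h2 | rfl
      · exact h.disjoint j k hjk h1 h2
      · exact hzQ j h1
    · by_cases hk : k = i
      · rw [Function.update_of_ne (fun e => hjk (e.trans hk.symm))] at hv
        exact hzQ j hv
      · rw [Function.update_of_ne hk] at hv'
        exact hzQ k hv'
  · intro j v hv
    rcases hmem j v hv with h1 | rfl
    · exact h.notMem j v h1
    · exact hzu
  · intro j v hv
    rcases hmem j v hv with h1 | rfl
    · exact h.mem j v h1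
    · exact hz

/-- The part of the path at `u j` from `z` on is cut off and attached to `u i` instead. The total
length stays the same. -/
theorem IsLinkage.update_swap (h : IsLinkage G S u Q) {i j : ZMod c} {z : V} {L R : List V}
    (hij : i ≠ j) (hi : Q i = []) (hadj : G.Adj (u i) z) (hj : Q j = L ++ z :: R) :
    IsLinkage G S u (Function.update (Function.update Q i (z :: R)) j L) := by
  set Q' := Function.update (Function.update Q i (z :: R)) j L with hQ'
  have hQj : Q' j = L := by simp [hQ']
  have hQi : Q' i = z :: R := by simp [hQ', hij]
  have hQk : ∀ k, k ≠ i → k ≠ j → Q' k = Q k := by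
    intro k h1 h2; simp [hQ', h1, h2]
  have hnod := h.nodup j
  rw [hj, List.nodup_append'] at hnod
  have hLj : ∀ v ∈ L, v ∈ Q j := fun v hv => by rw [hj]; simp [hv]
  have hRj : ∀ v ∈ z :: R, v ∈ Q j := fun v hv => by
    rw [hj]; exact List.mem_append_right _ hv
  have hsub : ∀ k v, v ∈ Q' k → ∃ k', v ∈ Q k' := by
    intro k v hv
    by_cases h1 : k = i
    · subst h1; exact ⟨j, hRj v (hQi ▸ hv)⟩
    by_cases h2 : k = j
    · subst h2; exact ⟨k, hLj v (hQj ▸ hv)⟩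
    · exact ⟨k, hQk k h1 h2 ▸ hv⟩
  have hch := h.chain j
  rw [hj, ← List.cons_append, List.isChain_append] at hch
  refine ⟨?_, ?_, ?_, ?_, ?_⟩
  · intro k
    by_cases h1 : k = i
    · subst h1
      rw [hQi, List.isChain_cons]
      exact ⟨by simpa using hadj, hch.2.1⟩
    by_cases h2 : k = j
    · subst h2; rw [hQj]; exact hch.1
    · rw [hQk k h1 h2]; exact h.chain k
  · intro k
    by_cases h1 : k = i
    · subst h1; rw [hQi]; exact hnod.2.1
    by_cases h2 : k = j
    · subst h2; rw [hQj]; exact hnod.1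
    · rw [hQk k h1 h2]; exact h.nodup k
  · have key : ∀ k l, k ≠ l → l ≠ i → k ≠ j → ∀ v ∈ Q' k, v ∉ Q' l := by
      intro k l hkl hli hkj v hv hv'
      by_cases h2 : l = j
      · subst h2
        rw [hQj] at hv'
        by_cases h1 : k = i
        · subst h1
          rw [hQi] at hv
          exact hnod.2.2 hv' hv
        · rw [hQk k h1 hkj] at hv
          exact h.disjoint k l hkl hv (hLj v hv')
      · rw [hQk l hli h2] at hv'
        by_cases h1 : k = i
        · subst h1
          rw [hQi] at hv
          exact h.disjoint j l (Ne.symm h2) (hRj v hv) hv'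
        · rw [hQk k h1 hkj] at hv
          exact h.disjoint k l hkl hv hv'
    intro k l hkl v hv hv'
    by_cases h1 : l = i
    · by_cases h2 : k = j
      · exact key l k hkl.symm (h2 ▸ hij.symm) (h1 ▸ hij) v hv' hv
      · by_cases h3 : k = i
        · exact hkl (h3.trans h1.symm)
        · exact key l k hkl.symm h3 (h1 ▸ hij) v hv' hv
    · by_cases h2 : k = j
      · by_cases h3 : l = j
        · exact hkl (h2.trans h3.symm)
        · exact key l k hkl.symm (h2 ▸ hij.symm) h3 v hv' hv
      · exact key k l hkl h1 h2 v hv hv'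
  · intro k v hv
    obtain ⟨k', hk'⟩ := hsub k v hv
    exact h.notMem k' v hk'
  · intro k v hv
    obtain ⟨k', hk'⟩ := hsub k v hv
    exact h.mem k' v hk'

/-- Maximize the total length of the paths and, among those linkages, the number of nontrivial
paths. -/
theorem exists_isMaxLinkage [Fintype V] [NeZero c] (G : SimpleGraph V) (S : Set V)
    (u : ZMod c → V) : ∃ Q, IsMaxLinkage G S u Q := by
  classical
  -- The second term is at most `c`, so the factor `c + 1` makes this order lexicographic.
  let μ : (ZMod c → List V) → ℕ := fun Q =>
    (c + 1) * ∑ i, (Q i).length + (univ.filter fun i => Q i ≠ []).card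
  have hcard : ∀ Q : ZMod c → List V, (univ.filter fun i => Q i ≠ []).card ≤ c := by
    intro Q
    simpa using card_le_univ (univ.filter fun i => Q i ≠ [])
  let P : ℕ → Prop := fun k => ∃ Q, IsLinkage G S u Q ∧ μ Q = k
  have hbd : ∀ k, P k → k ≤ (c + 1) * Fintype.card V + c := by
    rintro k ⟨Q, hQ, rfl⟩
    exact Nat.add_le_add (Nat.mul_le_mul_left _ hQ.sum_length_le) (hcard Q)
  have h0 : P (μ fun _ => []) :=
    ⟨_, ⟨by simp, by simp, by simp, by simp, by simp⟩, rfl⟩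
  obtain ⟨Q, hQ, hμ⟩ := Nat.findGreatest_spec (P := P) (hbd _ h0) h0
  have hmax : ∀ Q', IsLinkage G S u Q' → μ Q' ≤ μ Q := by
    intro Q' hQ'
    rw [hμ]
    exact Nat.le_findGreatest (hbd _ ⟨Q', hQ', rfl⟩) ⟨Q', hQ', rfl⟩
  refine ⟨Q, hQ, ?_, ?_⟩
  · intro i z hz hadj
    by_contra hcon
    push Not at hcon
    have h1 := hmax _ (hQ.update_append hz hadj hcon.1 hcon.2)
    have h2 : ∑ k, (Q k).length < ∑ k, (Function.update Q i (Q i ++ [z]) k).length := by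
      refine sum_lt_sum (fun k _ => ?_) ⟨i, mem_univ _, by simp⟩
      by_cases hk : k = i
      · subst hk; simp
      · simp [hk]
    have h3 := hcard Q
    have h4 : (c + 1) * (∑ k, (Q k).length + 1) ≤ (c + 1) *
      ∑ k, (Function.update Q i (Q i ++ [z]) k).length := Nat.mul_le_mul_left _ h2
    simp only [μ] at h1
    rw [mul_add] at h4
    omega
  · intro i hi z hadj j hzj
    by_contra hcon
    obtain ⟨L, R, hj⟩ := List.append_of_mem hzj
    -- As `z` is not the head, the path at `u j` stays nontrivial after the swap while the one at `u
    -- i` becomes so.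
    have hL : L ≠ [] := by
      rintro rfl; rw [hj] at hcon; simp at hcon
    have hij : i ≠ j := by
      rintro rfl; rw [hi] at hzj; simp at hzj
    have h1 := hmax _ (hQ.update_swap hij hi hadj hj)
    set Q' := Function.update (Function.update Q i (z :: R)) j L with hQ'
    have hQj : Q' j = L := by simp [hQ']
    have hQi : Q' i = z :: R := by simp [hQ', hij]
    have hQk : ∀ k, k ≠ i → k ≠ j → Q' k = Q k := by
      intro k h1 h2; simp [hQ', h1, h2]
    have h2 : ∑ k, (Q' k).length = ∑ k, (Q k).length := by
      have hpt : ∀ k, (Q' k).length + (if k = j then R.length + 1 else 0)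
          = (Q k).length + (if k = i then R.length + 1 else 0) := by
        intro k
        by_cases h1 : k = i
        · subst h1; simp [hQi, hi, hij]
        by_cases h2 : k = j
        · subst h2; simp [hQj, hj, hij.symm]
        · simp [h1, h2, hQk k h1 h2]
      have := sum_congr rfl (fun k (_ : k ∈ (univ : Finset (ZMod c))) => hpt k)
      rw [sum_add_distrib, sum_add_distrib] at this
      simpa using this
    have h3 : (univ.filter fun k => Q k ≠ []).card < (univ.filter fun k => Q' k ≠ []).card := by
      refine card_lt_card ⟨?_, ?_⟩
      · intro k hk
        simp only [mem_filter, mem_univ, true_and] at hk ⊢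
        by_cases h1 : k = i
        · subst h1; simp [hQi]
        by_cases h2 : k = j
        · subst h2; rwa [hQj]
        · rwa [hQk k h1 h2]
      · intro hsub
        have := @hsub i (by simp [hQi])
        simp [hi] at this
    simp only [μ] at h1
    rw [h2] at h1
    omega

end linkage

/-! ### Neighbours in `S` of the ends of nontrivial paths. -/

open Classical in
/-- The neighbours of `v` in `S`. -/
noncomputable def nbrsIn {V : Type*} [Fintype V] (G : SimpleGraph V) (S : Set V) (v : V) :
    Finset V :=
  univ.filter fun z => z ∈ S ∧ G.Adj v z

@[simp] theorem mem_nbrsIn {V : Type*} [Fintype V] {G : SimpleGraph V} {S : Set V} {v z : V} :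
    z ∈ nbrsIn G S v ↔ z ∈ S ∧ G.Adj v z := by
  simp [nbrsIn]

section
variable {V : Type*} {G : SimpleGraph V} {S : Set V} {c : ℕ} {u : ZMod c → V}
  {Q : ZMod c → List V}

theorem linkEnd_of_eq_nil {i : ZMod c} (h : Q i = []) : linkEnd u Q i = u i := by
  simp [linkEnd, h]

theorem dropLast_append_linkEnd {i : ZMod c} (h : Q i ≠ []) :
    (Q i).dropLast ++ [linkEnd u Q i] = Q i := by
  rw [linkEnd, List.getLast_cons h, List.dropLast_append_getLast]

theorem linkEnd_mem {i : ZMod c} (h : Q i ≠ []) : linkEnd u Q i ∈ Q i := by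
  rw [linkEnd, List.getLast_cons h]; exact List.getLast_mem h

theorem IsLinkage.nodup_cons (h : IsLinkage G S u Q) (i : ZMod c) : (u i :: Q i).Nodup :=
  List.nodup_cons.2 ⟨fun h' => h.notMem i _ h' ⟨i, rfl⟩, h.nodup i⟩

theorem IsLinkage.joins_dropLast (h : IsLinkage G S u Q) {i : ZMod c} (hi : Q i ≠ []) :
    Joins G (u i) (Q i).dropLast (linkEnd u Q i) := by
  rw [Joins, dropLast_append_linkEnd hi]; exact h.chain i

/-- A nonempty set of neighbours of `v` on a path of a linkage is contained in an initial part of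
this path that ends in a neighbour of `v`. -/
theorem IsLinkage.exists_joins (h : IsLinkage G S u Q) {j : ZMod c} {v : V} {T : Finset V}
    (hT : T.Nonempty) (hTQ : ∀ t ∈ T, t ∈ u j :: Q j) (hv : ∀ t ∈ T, G.Adj v t) :
    ∃ l, l <+: Q j ∧ Joins G (u j) l v ∧ T.card ≤ l.length + 1 := by
  classical
  obtain ⟨p, b, q, hpq, hb, hp⟩ := exists_prefix_of_forall_mem T hT _ hTQ
  have hpre : p ++ [b] <+: u j :: Q j := ⟨q, by rw [hpq]; simp⟩
  have hcard : T.card ≤ (p ++ [b]).length :=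
    (card_le_card (fun t ht => List.mem_toFinset.2 (hp t ht))).trans (List.toFinset_card_le _)
  obtain ⟨l, hl⟩ : ∃ l, p ++ [b] = u j :: l := by
    rcases p with _ | ⟨a, p⟩
    · simp at hpq; exact ⟨[], by simp [hpq.1]⟩
    · simp at hpq; exact ⟨p ++ [b], by simp [hpq.1]⟩
  have hlast : (p ++ [b]).getLast (by simp) = b := by simp
  rw [hl] at hpre hcard
  refine ⟨l, (List.cons_prefix_cons.1 hpre).2, joins_iff.2 ⟨(h.chain j).prefix hpre, ?_⟩, ?_⟩
  · simp only [hl] at hlast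
    rw [hlast]; exact (hv b hb).symm
  · simpa using hcard

variable [NeZero c]

/-- An end of a nontrivial path of a maximal linkage has small degree. -/
theorem IsMaxLinkage.card_nbrsIn_lt [Fintype V] (hQ : IsMaxLinkage G S u Q)
    (hu : IsRing G u) (hS : CycleBound G S c) (huS : Set.range u ⊆ S) {i : ZMod c}
    (hi : Q i ≠ []) :
    (nbrsIn G S (linkEnd u Q i)).card + 1 ≤ c ∧
      (2 * (Q i).length ≤ c → 2 * (nbrsIn G S (linkEnd u Q i)).card ≤ c) := by
  classical
  set v := linkEnd u Q i with hv
  have hvQ : v ∈ Q i := linkEnd_mem hi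
  let T : ZMod c → Finset V := fun j => (nbrsIn G S v).filter fun z => z ∈ u j :: Q j
  have hT : ∀ j, ∀ t ∈ T j, t ∈ u j :: Q j := fun j t ht => (mem_filter.1 ht).2
  have hTv : ∀ j, ∀ t ∈ T j, G.Adj v t := fun j t ht => (mem_nbrsIn.1 (mem_filter.1 ht).1).2
  have hcov : nbrsIn G S v ⊆ univ.biUnion T := by
    intro z hz
    have hz' := mem_nbrsIn.1 hz
    rw [mem_biUnion]
    rcases hQ.closed i z hz'.1 hz'.2 with ⟨j, rfl⟩ | ⟨j, hj⟩
    · exact ⟨j, mem_univ _, mem_filter.2 ⟨hz, by simp⟩⟩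
    · exact ⟨j, mem_univ _, mem_filter.2 ⟨hz, by simp [hj]⟩⟩
  have hTi : (T i).card ≤ (Q i).length := by
    have h1 : T i ⊆ ((u i :: Q i).toFinset).erase v := by
      intro z hz
      exact mem_erase.2 ⟨(hTv i z hz).ne', List.mem_toFinset.2 (hT i z hz)⟩
    have h2 := card_le_card h1
    rw [card_erase_of_mem (by simp [hvQ])] at h2
    have h3 := List.toFinset_card_le (u i :: Q i)
    rw [List.length_cons] at h3
    omega
  set J := univ.filter fun j => j ≠ i ∧ (T j).Nonempty with hJ
  have hcovJ : (nbrsIn G S v).card ≤ (T i).card + ∑ j ∈ J, (T j).card := by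
    have h1 : nbrsIn G S v ⊆ T i ∪ J.biUnion T := by
      intro z hz
      obtain ⟨j, -, hj⟩ := mem_biUnion.1 (hcov hz)
      by_cases hji : j = i
      · subst hji; exact mem_union_left _ hj
      · exact mem_union_right _ (mem_biUnion.2
          ⟨j, mem_filter.2 ⟨mem_univ _, hji, ⟨z, hj⟩⟩, hj⟩)
    exact (card_le_card h1).trans ((card_union_le _ _).trans
      (Nat.add_le_add_left card_biUnion_le _))
  have hpath : ∀ j ∈ J, ∃ l, l <+: Q j ∧ Joins G (u j) l v ∧ (T j).card ≤ l.length + 1 :=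
    fun j hj => hQ.exists_joins (mem_filter.1 hj).2.2 (hT j) (hTv j)
  have hcpos : 0 < c := NeZero.pos c
  rcases J.eq_empty_or_nonempty with hJe | ⟨j₀, hj₀⟩
  · rw [hJe, sum_empty, add_zero] at hcovJ
    refine ⟨?_, fun h => by omega⟩
    rcases (T i).eq_empty_or_nonempty with hTe | hTn
    · rw [hTe, card_empty] at hcovJ; omega
    · have hrev : (u i :: Q i).reverse = v :: (u i :: (Q i).dropLast).reverse := by
        conv_lhs => rw [← dropLast_append_linkEnd (u := u) hi]
        simp [hv]
      have h1 : (T i).card + 1 ≤ c := by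
        refine hS.card_add_one_le (a := v) (l := (u i :: (Q i).dropLast).reverse) ?_ ?_ ?_ hTn ?_
        · rw [← hrev, List.nodup_reverse]; exact hQ.nodup_cons i
        · rw [← hrev, List.isChain_reverse]
          exact (hQ.chain i).imp fun _ _ h => h.symm
        · rw [← hrev]
          intro w hw
          rw [List.mem_reverse, List.mem_cons] at hw
          rcases hw with rfl | hw
          · exact huS ⟨i, rfl⟩
          · exact hQ.mem i w hw
        · intro t ht
          have h2 := hT i t ht
          rw [← List.mem_reverse, hrev, List.mem_cons] at h2
          exact ⟨h2.resolve_left (hTv i t ht).ne', hTv i t ht⟩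
      omega
  · choose! l hl hlj hlc using hpath
    -- Detours through `v` from `u i` to `u j`, or from `u j` to `u j'`, have one inner vertex less
    -- than the sum of the two radii. As `u` is longest, intervals with these radii do not overlap,
    -- so `2 * ∑ r ≤ c`, while `∑ r` bounds the number of neighbours of `v` in `S`.
    let r : ZMod c → ℕ := fun j => if j = i then (Q i).length else (l j).length + 1
    have hiJ : i ∉ J := fun h => (mem_filter.1 h).2.1 rfl
    have hrJ : ∀ j ∈ J, r j = (l j).length + 1 := fun j hj => by
      have : j ≠ i := fun e => hiJ (e ▸ hj)
      simp [r, this]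
    have hri : r i = (Q i).length := by simp [r]
    have hlQ : ∀ j ∈ J, ∀ w ∈ l j, w ∈ Q j := fun j hj w hw => (hl j hj).subset hw
    have hln : ∀ j ∈ J, (l j).Nodup := fun j hj => (hQ.nodup j).sublist (hl j hj).sublist
    have hij : ∀ j ∈ J, r i + r j ≤ (j - i).val ∧ r j + r i ≤ (i - j).val := by
      intro j hj
      have hne : i ≠ j := fun e => hiJ (e ▸ hj)
      have hjn : Joins G (u i) (Q i ++ (l j).reverse) (u j) := by
        have := (hQ.joins_dropLast hi).trans (hlj j hj).symm
        rw [← hv, List.append_cons, dropLast_append_linkEnd hi] at this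
        exact this
      have hnd : (Q i ++ (l j).reverse).Nodup := by
        rw [List.nodup_append', List.nodup_reverse]
        refine ⟨hQ.nodup i, hln j hj, ?_⟩
        intro w hw hw'
        exact hQ.disjoint i j hne hw (hlQ j hj w (List.mem_reverse.1 hw'))
      have hmem : ∀ w ∈ Q i ++ (l j).reverse, ∃ k, w ∈ Q k := by
        intro w hw
        rw [List.mem_append, List.mem_reverse] at hw
        exact hw.elim (fun h => ⟨i, h⟩) (fun h => ⟨j, hlQ j hj w h⟩)
      have hmS : ∀ w ∈ Q i ++ (l j).reverse, w ∈ S :=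
        fun w hw => (hmem w hw).elim fun k hk => hQ.mem k w hk
      have hmu : ∀ w ∈ Q i ++ (l j).reverse, w ∉ Set.range u :=
        fun w hw => (hmem w hw).elim fun k hk => hQ.notMem k w hk
      have h1 := hu.length_lt hS huS hne hjn hnd hmS hmu
      have h2 := hu.length_lt hS huS hne.symm hjn.symm (List.nodup_reverse.2 hnd)
        (fun w hw => hmS w (List.mem_reverse.1 hw)) (fun w hw => hmu w (List.mem_reverse.1 hw))
      simp only [List.length_reverse, List.length_append] at h1 h2
      rw [hri, hrJ j hj]
      omega
    have hjj : ∀ j ∈ J, ∀ j' ∈ J, j ≠ j' → r j + r j' ≤ (j' - j).val := by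
      intro j hj j' hj' hne
      have hji : j ≠ i := fun e => hiJ (e ▸ hj)
      have hji' : j' ≠ i := fun e => hiJ (e ▸ hj')
      have hjn := (hlj j hj).trans (hlj j' hj').symm
      have hvl : ∀ k ∈ J, k ≠ i → v ∉ l k := fun k hk hki h =>
        hQ.disjoint k i hki (hlQ k hk v h) hvQ
      have hnd : (l j ++ v :: (l j').reverse).Nodup := by
        rw [List.nodup_append', List.nodup_cons, List.nodup_reverse, List.mem_reverse]
        refine ⟨hln j hj, ⟨hvl j' hj' hji', hln j' hj'⟩, ?_⟩
        intro w hw hw'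
        rw [List.mem_cons, List.mem_reverse] at hw'
        rcases hw' with rfl | hw'
        · exact hvl j hj hji hw
        · exact hQ.disjoint j j' hne (hlQ j hj w hw) (hlQ j' hj' w hw')
      have hmem : ∀ w ∈ l j ++ v :: (l j').reverse, ∃ k, w ∈ Q k := by
        intro w hw
        rw [List.mem_append, List.mem_cons, List.mem_reverse] at hw
        rcases hw with h | rfl | h
        · exact ⟨j, hlQ j hj w h⟩
        · exact ⟨i, hvQ⟩
        · exact ⟨j', hlQ j' hj' w h⟩
      have h1 := hu.length_lt hS huS hne hjn hnd
        (fun w hw => (hmem w hw).elim fun k hk => hQ.mem k w hk)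
        (fun w hw => (hmem w hw).elim fun k hk => hQ.notMem k w hk)
      simp only [List.length_reverse, List.length_append, List.length_cons] at h1
      rw [hrJ j hj, hrJ j' hj']
      omega
    have hWn : (insert i J).Nontrivial :=
      ⟨i, by simp, j₀, by simp [hj₀], fun e => hiJ (e ▸ hj₀)⟩
    have hsum := ZMod.sum_radii_le hWn r r (by
      intro w hw w' hw' hne
      rw [mem_insert] at hw hw'
      rcases hw with rfl | hw
      · exact (hij w' (hw'.resolve_left hne.symm)).1
      · rcases hw' with rfl | hw'
        · exact (hij w hw).2
        · exact hjj w hw w' hw' hne)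
    rw [sum_insert hiJ, sum_add_distrib, hri] at hsum
    have h1 : ∑ j ∈ J, (T j).card ≤ ∑ j ∈ J, r j :=
      sum_le_sum fun j hj => hrJ j hj ▸ hlc j hj
    have h2 : 2 ≤ c := two_le_of_ne (fun e => hiJ (e ▸ hj₀) : i ≠ j₀)
    constructor
    · omega
    · intro _; omega

end

/-! ### Trivial paths and the exceptional ends. -/

section
variable {V : Type*} {c : ℕ}

open Classical in
/-- The indices of the paths whose first vertex outside the ring is adjacent to `u i`. -/
noncomputable def headNbrs [NeZero c] (G : SimpleGraph V) (u : ZMod c → V) (Q : ZMod c → List V)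
    (i : ZMod c) : Finset (ZMod c) :=
  univ.filter fun j => ∃ z, (Q j).head? = some z ∧ G.Adj (u i) z

open Classical in
/-- The indices of the vertices of the ring, other than `u i`, that are not adjacent to `u i`. -/
noncomputable def nonNbrs [NeZero c] (G : SimpleGraph V) (u : ZMod c → V) (i : ZMod c) :
    Finset (ZMod c) :=
  univ.filter fun j => j ≠ i ∧ ¬ G.Adj (u i) (u j)

variable {G : SimpleGraph V} {S : Set V} {u : ZMod c → V} {Q : ZMod c → List V} [NeZero c]

theorem mem_headNbrs {i j : ZMod c} :
    j ∈ headNbrs G u Q i ↔ ∃ z, (Q j).head? = some z ∧ G.Adj (u i) z := by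
  simp [headNbrs]

theorem mem_nonNbrs {i j : ZMod c} :
    j ∈ nonNbrs G u i ↔ j ≠ i ∧ ¬ G.Adj (u i) (u j) := by
  simp [nonNbrs]

theorem ne_nil_of_mem_headNbrs {i j : ZMod c} (h : j ∈ headNbrs G u Q i) : Q j ≠ [] := by
  obtain ⟨z, hz, -⟩ := mem_headNbrs.1 h
  rintro h0
  simp [h0] at hz

/-- If the path at `u i` is trivial and `u i` is adjacent to the head of another path, then this
head is a common neighbour of `u i` and `u j` outside the ring. -/
theorem IsLinkage.exists_common_nbr (hQ : IsLinkage G S u Q) {i j : ZMod c}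
    (h : j ∈ headNbrs G u Q i) :
    ∃ z ∈ S, z ∉ Set.range u ∧ G.Adj (u i) z ∧ G.Adj (u j) z := by
  obtain ⟨z, hz, hadj⟩ := mem_headNbrs.1 h
  have hzQ : z ∈ Q j := List.mem_of_mem_head? hz
  exact ⟨z, hQ.mem j z hzQ, hQ.notMem j z hzQ, hadj, (hQ.chain j).rel_head? hz⟩

theorem ne_of_mem_headNbrs {i j : ZMod c} (hi : Q i = []) (h : j ∈ headNbrs G u Q i) :
    i ≠ j := by
  rintro rfl
  exact ne_nil_of_mem_headNbrs h hi

/-- By maximality, a neighbour of `u i` in `S` is on the ring or the head of a path. The ring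
provides `c - 1` neighbours minus the nonneighbours. -/
theorem IsMaxLinkage.card_nbrsIn_add_le [Fintype V] (hQ : IsMaxLinkage G S u Q)
    {i : ZMod c} (hi : Q i = []) :
    (nbrsIn G S (linkEnd u Q i)).card + (nonNbrs G u i).card + 1
      ≤ c + (headNbrs G u Q i).card := by
  classical
  set A := univ.filter fun j => G.Adj (u i) (u j) with hA
  have hAc : A.card + (nonNbrs G u i).card + 1 = c := by
    have h1 : insert i (A ∪ nonNbrs G u i) = univ := by
      ext j
      simp only [mem_insert, mem_union, hA, mem_filter, mem_univ, true_and, mem_nonNbrs]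
      tauto
    have h2 : Disjoint A (nonNbrs G u i) := by
      rw [Finset.disjoint_left]
      intro j hj hj'
      exact (mem_nonNbrs.1 hj').2 (mem_filter.1 hj).2
    have h3 : i ∉ A ∪ nonNbrs G u i := by
      simp [hA, mem_nonNbrs]
    rw [← card_union_of_disjoint h2, ← card_insert_of_notMem h3, h1, card_univ, ZMod.card]
  have hcov : nbrsIn G S (linkEnd u Q i) ⊆
      A.image u ∪ (headNbrs G u Q i).image (fun j => (Q j).headD (u j)) := by
    intro z hz
    rw [mem_nbrsIn] at hz
    have hz2 := hz.2
    rw [linkEnd_of_eq_nil hi] at hz2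
    rw [mem_union, mem_image, mem_image]
    rcases hQ.closed i z hz.1 hz.2 with ⟨j, rfl⟩ | ⟨j, hj⟩
    · exact Or.inl ⟨j, mem_filter.2 ⟨mem_univ _, hz2⟩, rfl⟩
    · have h1 := hQ.head i hi z hz2 j hj
      exact Or.inr ⟨j, mem_headNbrs.2 ⟨z, h1, hz2⟩, by rw [List.headD_eq_head?_getD, h1]; rfl⟩
  have h1 := (card_le_card hcov).trans ((card_union_le _ _).trans
    (Nat.add_le_add card_image_le card_image_le))
  omega

variable (hu : IsRing G u) (hS : CycleBound G S c) (huS : Set.range u ⊆ S)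
include hu hS huS

/-- The head of the path at `u j` is a common neighbour of `u i` and `u j` off the ring, so `u (i +
1)` and `u (j + 1)` are not adjacent. -/
theorem IsLinkage.card_headNbrs_le_succ (hQ : IsLinkage G S u Q) {i : ZMod c} (hi : Q i = []) :
    (headNbrs G u Q i).card ≤ (nonNbrs G u (i + 1)).card := by
  refine card_le_card_of_injOn (· + 1) ?_ (add_left_injective 1).injOn
  intro j hj
  obtain ⟨z, hzS, hzu, h1, h2⟩ := hQ.exists_common_nbr hj
  have hij := ne_of_mem_headNbrs hi hj
  exact mem_nonNbrs.2 ⟨fun e => hij (add_right_cancel e).symm,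
    hu.not_adj_succ hS huS hij hzS hzu h1 h2⟩

theorem IsLinkage.card_headNbrs_le_pred (hQ : IsLinkage G S u Q) {i : ZMod c} (hi : Q i = []) :
    (headNbrs G u Q i).card ≤ (nonNbrs G u (i - 1)).card := by
  refine card_le_card_of_injOn (· - 1) ?_ (sub_left_injective).injOn
  intro j hj
  obtain ⟨z, hzS, hzu, h1, h2⟩ := hQ.exists_common_nbr hj
  have hij := ne_of_mem_headNbrs hi hj
  exact mem_nonNbrs.2 ⟨fun e => hij (sub_left_injective e).symm,
    hu.not_adj_pred hS huS hij hzS hzu h1 h2⟩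

/-- All ends of the paths of a maximal linkage, up to a set of fewer than half of them, have
degree less than `c`. -/
theorem IsMaxLinkage.exists_exceptional [Fintype V] (hQ : IsMaxLinkage G S u Q) :
    ∃ X : Finset (ZMod c), (∀ k ∈ X, k + 1 ∉ X) ∧ 2 * X.card < c ∧ (∀ k ∈ X, Q k = []) ∧
      ∀ k ∉ X, (nbrsIn G S (linkEnd u Q k)).card + 1 ≤ c := by
  classical
  set X := univ.filter fun k => c ≤ (nbrsIn G S (linkEnd u Q k)).card with hX
  have hXQ : ∀ k ∈ X, Q k = [] := by
    intro k hk
    by_contra hne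
    have h1 := (hQ.card_nbrsIn_lt hu hS huS hne).1
    have h2 := (mem_filter.1 hk).2
    omega
  have hlt : ∀ k ∈ X, (nonNbrs G u k).card < (headNbrs G u Q k).card := by
    intro k hk
    have h1 := hQ.card_nbrsIn_add_le (hXQ k hk)
    have h2 := (mem_filter.1 hk).2
    omega
  -- Otherwise nonneighbours at `k` < heads at `k` ≤ nonneighbours at `k + 1` < heads at `k + 1` ≤
  -- nonneighbours at `k`.
  have hXs : ∀ k ∈ X, k + 1 ∉ X := by
    intro k hk hk'
    have h1 := hlt k hk
    have h2 := hlt _ hk'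
    have h3 := hQ.card_headNbrs_le_succ hu hS huS (hXQ k hk)
    have h4 := hQ.card_headNbrs_le_pred hu hS huS (hXQ _ hk')
    rw [add_sub_cancel_right] at h4
    omega
  refine ⟨X, hXs, ?_, hXQ, fun k hk => ?_⟩
  · have hle : 2 * X.card ≤ c := by
      have := ZMod.two_mul_card_le_of_succ_notMem hXs (subset_univ _) (subset_univ _)
      rwa [card_univ, ZMod.card] at this
    refine lt_of_le_of_ne hle fun heq => ?_
    -- If `X` were half of the ring, it would alternate with its complement. Counting the pairs `k ∈
    -- X`, `j ∉ X` with `j ∈ headNbrs G u Q k` from the side of `j` would then bound the heads by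
    -- the nonneighbours at the points `j + 1 ∈ X`, against `hlt`.
    have hcompl : X.card = Xᶜ.card := by rw [card_compl, ZMod.card]; omega
    have hmap : X.map (addRightEmbedding 1) = Xᶜ := by
      refine eq_of_subset_of_card_le ?_ (by rw [card_map, hcompl])
      intro x hx
      simp only [mem_map, addRightEmbedding_apply] at hx
      obtain ⟨y, hy, rfl⟩ := hx
      exact mem_compl.2 (hXs y hy)
    have hcX : ∀ j ∉ X, j + 1 ∈ X := by
      intro j hj
      by_contra hj'
      rw [← mem_compl, ← hmap] at hj'
      simp only [mem_map, addRightEmbedding_apply] at hj'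
      obtain ⟨y, hy, hyj⟩ := hj'
      exact hj (add_right_cancel hyj ▸ hy)
    have hXn : X.Nonempty := by
      rw [← card_pos]
      have := NeZero.pos c
      omega
    have h1 : ∑ k ∈ X, (nonNbrs G u k).card < ∑ k ∈ X, (headNbrs G u Q k).card :=
      sum_lt_sum_of_nonempty hXn hlt
    have h2 : ∑ k ∈ X, (headNbrs G u Q k).card
        = ∑ j ∈ Xᶜ, (X.filter fun k => j ∈ headNbrs G u Q k).card := by
      refine Eq.trans ?_ (sum_card_bipartiteAbove_eq_sum_card_bipartiteBelow
        (fun k j => j ∈ headNbrs G u Q k))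
      refine sum_congr rfl fun k _ => ?_
      congr 1
      ext j
      simp only [mem_bipartiteAbove, mem_compl]
      exact ⟨fun h => ⟨fun hj => ne_nil_of_mem_headNbrs h (hXQ j hj), h⟩, fun h => h.2⟩
    have h3 : ∀ j ∈ Xᶜ, (X.filter fun k => j ∈ headNbrs G u Q k).card
        ≤ (nonNbrs G u (j + 1)).card := by
      intro j _
      refine card_le_card_of_injOn (· + 1) ?_ (add_left_injective 1).injOn
      intro k hk
      obtain ⟨hkX, hk⟩ := mem_filter.1 hk
      obtain ⟨z, hzS, hzu, h1, h2⟩ := hQ.exists_common_nbr hk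
      have hij := ne_of_mem_headNbrs (hXQ k hkX) hk
      exact mem_nonNbrs.2 ⟨fun e => hij (add_right_cancel e),
        hu.not_adj_succ hS huS hij.symm hzS hzu h2 h1⟩
    have h4 : ∑ j ∈ Xᶜ, (nonNbrs G u (j + 1)).card ≤ ∑ k ∈ X, (nonNbrs G u k).card := by
      have : ∑ j ∈ Xᶜ, (nonNbrs G u (j + 1)).card
          = ∑ k ∈ Xᶜ.map (addRightEmbedding 1), (nonNbrs G u k).card := by
        rw [sum_map]; rfl
      rw [this]
      refine sum_le_sum_of_subset ?_
      intro x hx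
      simp only [mem_map, addRightEmbedding_apply] at hx
      obtain ⟨y, hy, rfl⟩ := hx
      exact hcX y (mem_compl.1 hy)
    have h5 := sum_le_sum h3
    omega
  · have : ¬ c ≤ (nbrsIn G S (linkEnd u Q k)).card := fun h =>
      hk (mem_filter.2 ⟨mem_univ _, h⟩)
    omega

omit huS hS in
/-- The ends of two paths of a linkage are connected by paths of two lengths, one for each
direction on the ring. -/
theorem IsLinkage.exists_joins_ends (hQ : IsLinkage G S u Q) {k l : ZMod c} (hkl : k ≠ l)
    (huS : Set.range u ⊆ S) {a b : V} (ha : G.Adj (linkEnd u Q k) a)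
    (hb : G.Adj (linkEnd u Q l) b) :
    ∃ T : List V, Joins G a T b ∧ T.Nodup ∧ (∀ v ∈ T, v ∈ S) ∧
      T.length = (Q k).length + (l - k).val + 1 + (Q l).length := by
  have hc := two_le_of_ne hkl
  have hpos := ZMod.val_sub_pos hkl
  have hlt := ZMod.val_lt (l - k)
  have hkd := ZMod.add_val_sub k l
  set d := (l - k).val
  obtain ⟨e, he⟩ : ∃ e, d = e + 1 := ⟨d - 1, by omega⟩
  have hseg : seg u k (d + 1) = u k :: (seg u (k + 1) e ++ [u l]) := by
    rw [seg_succ, hkd, he, seg_succ', List.cons_append]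
  have h1 : Joins G (u k) (seg u (k + 1) e) (u l) := by
    rw [Joins, ← hseg]; exact isChain_seg _ hu hc _
  have h2 : Joins G (u k) (Q k) a := joins_iff.2 ⟨hQ.chain k, ha⟩
  have h3 : Joins G (u l) (Q l) b := joins_iff.2 ⟨hQ.chain l, hb⟩
  have h4 := (h2.symm.trans h1).trans h3
  have hT : (Q k).reverse ++ u k :: seg u (k + 1) e ++ u l :: Q l
      = (Q k).reverse ++ seg u k (d + 1) ++ Q l := by
    rw [hseg]; simp
  rw [hT] at h4
  refine ⟨_, h4, ?_, ?_, ?_⟩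
  · rw [List.nodup_append', List.nodup_append', List.nodup_reverse]
    refine ⟨⟨hQ.nodup k, nodup_seg _ hu.inj (by omega), ?_⟩, hQ.nodup l, ?_⟩
    · intro v hv hv'
      exact hQ.notMem k v (List.mem_reverse.1 hv) (mem_range_of_mem_seg _ _ hv')
    · intro v hv hv'
      rw [List.mem_append, List.mem_reverse] at hv
      rcases hv with h | h
      · exact hQ.disjoint k l hkl h hv'
      · exact hQ.notMem l v hv' (mem_range_of_mem_seg _ _ h)
  · intro v hv
    rw [List.mem_append, List.mem_append, List.mem_reverse] at hv
    rcases hv with (h | h) | h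
    · exact hQ.mem k v h
    · exact huS (mem_range_of_mem_seg _ _ h)
    · exact hQ.mem l v h
  · simp; omega

end

/-! ### The main inequality. -/

/-- The main inequality, for a longest cycle `x` and a longest cycle `u` of its complement. -/
theorem mul_le_of_longest {V : Type*} [Fintype V] {G : SimpleGraph V} [DecidableRel G.Adj]
    {n c : ℕ} [NeZero n] [NeZero c] {x : ZMod n → V} {u : ZMod c → V} (hx : IsRing G x)
    (hu : IsRing G u) (hux : Set.range u ⊆ (Set.range x)ᶜ) (hG : CycleBound G Set.univ n)
    (hS : CycleBound G (Set.range x)ᶜ c) (hc : c < G.minDegree) :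
    (c + 1) * (G.minDegree - c + 1) ≤ n := by
  classical
  obtain ⟨Q, hQ⟩ := exists_isMaxLinkage G (Set.range x)ᶜ u
  obtain ⟨X, hXs, hXc, hXQ, hXd⟩ := hQ.exists_exceptional hu hS hux
  set S := (Set.range x)ᶜ with hSdef
  set N := G.minDegree - c + 1 with hN
  let Z : ZMod c → Finset (ZMod n) := fun k => univ.filter fun p => G.Adj (linkEnd u Q k) (x p)
  have hZ : ∀ {k p}, p ∈ Z k → G.Adj (linkEnd u Q k) (x p) := fun h => (mem_filter.1 h).2
  have hendS : ∀ k, linkEnd u Q k ∈ S := by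
    intro k
    by_cases hk : Q k = []
    · rw [linkEnd_of_eq_nil hk]; exact hux ⟨k, rfl⟩
    · exact hQ.mem k _ (linkEnd_mem hk)
  have hdeg : ∀ k, G.minDegree ≤ (nbrsIn G S (linkEnd u Q k)).card + (Z k).card := by
    intro k
    have h1 := G.minDegree_le_degree (linkEnd u Q k)
    rw [← card_neighborFinset_eq_degree] at h1
    have h2 : G.neighborFinset (linkEnd u Q k) ⊆ nbrsIn G S (linkEnd u Q k) ∪ (Z k).image x := by
      intro z hz
      rw [mem_neighborFinset] at hz
      rw [mem_union, mem_nbrsIn, mem_image]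
      by_cases hzx : z ∈ Set.range x
      · obtain ⟨p, rfl⟩ := hzx
        exact Or.inr ⟨p, mem_filter.2 ⟨mem_univ _, hz⟩, rfl⟩
      · exact Or.inl ⟨hzx, hz⟩
    exact h1.trans ((card_le_card h2).trans ((card_union_le _ _).trans
      (Nat.add_le_add_left card_image_le _)))
  have h2 : ∀ k l, ∀ p ∈ Z k, ∀ p' ∈ Z l, p ≠ p' → 2 ≤ (p' - p).val := by
    intro k l p hp p' hp' hpp
    by_cases hkl : k = l
    · subst hkl
      refine hx.length_lt hG (Set.subset_univ _) hpp (T := [linkEnd u Q k]) ?_ (by simp)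
        (fun _ _ => trivial) ?_
      · simpa [Joins] using ⟨(hZ hp).symm, hZ hp'⟩
      · intro v hv
        rw [List.mem_singleton.1 hv]
        exact hendS k
    · obtain ⟨T, hT, hTn, hTS, hTl⟩ := hQ.exists_joins_ends hu hkl hux (hZ hp) (hZ hp')
      have h1 := hx.length_lt hG (Set.subset_univ _) hpp hT hTn (fun _ _ => trivial) hTS
      omega
  have hd : ∀ k l, k ≠ l → ∀ p ∈ Z k, ∀ p' ∈ Z l, p ≠ p' →
      (Q k).length + (Q l).length + ((k - l).val + 2) ≤ (p' - p).val ∧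
      (Q k).length + (Q l).length + ((l - k).val + 2) ≤ (p' - p).val := by
    intro k l hkl p hp p' hp' hpp
    obtain ⟨T, hT, hTn, hTS, hTl⟩ := hQ.exists_joins_ends hu hkl hux (hZ hp) (hZ hp')
    obtain ⟨T', hT', hTn', hTS', hTl'⟩ := hQ.exists_joins_ends hu hkl.symm hux (hZ hp') (hZ hp)
    have h1 := hx.length_lt hG (Set.subset_univ _) hpp hT hTn (fun _ _ => trivial) hTS
    have h2 := hx.length_lt hG (Set.subset_univ _) hpp hT'.symm (List.nodup_reverse.2 hTn')
      (fun _ _ => trivial) (fun v hv => hTS' v (List.mem_reverse.1 hv))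
    rw [List.length_reverse] at h2
    omega
  have hZN : ∀ k ∉ X, N ≤ (Z k).card := by
    intro k hk
    have h1 := hXd k hk
    have h3 := hdeg k
    omega
  by_cases hfar : X.Nonempty ∧ ∃ i, c + 1 ≤ 2 * (Q i).length
  · obtain ⟨hXn, i, hi⟩ := hfar
    have hiX : i ∉ X := fun h => by
      rw [hXQ i h] at hi; simp at hi
    -- The exceptional ends are discarded. The two arcs between `u k` and `u l` add up to `c`, so
    -- the longer one together with the path at `u i` exceeds `c`.
    let Z' : ZMod c → Finset (ZMod n) := fun k => if k ∈ X then ∅ else Z k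
    have hZ' : ∀ k, Z' k ⊆ Z k := by
      intro k
      by_cases hk : k ∈ X
      · simp [Z', hk]
      · simp [Z', hk]
    have hXpos := hXn.card_pos
    refine mul_le_of_dist_of_far (Z := Z') (by omega) (by omega) hXs hXc
      (fun k hk => by simp [Z', hk]) (fun k hk => by simpa [Z', hk] using hZN k hk) hiX ?_ ?_ ?_
    · exact fun k l p hp p' hp' => h2 k l p (hZ' k hp) p' (hZ' l hp')
    · intro k l hkl p hp p' hp' hpp
      have := hd k l hkl p (hZ' k hp) p' (hZ' l hp') hpp
      omega
    · intro k l hkl hkli p hp p' hp' hpp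
      have h3 := hd k l hkl p (hZ' k hp) p' (hZ' l hp') hpp
      have h4 := ZMod.val_sub_add_val_sub hkl
      rcases hkli with rfl | rfl
      · omega
      · omega
  · have hpt : ∀ k, (nbrsIn G S (linkEnd u Q k)).card + 1 + (if Q k ≠ [] then X.card else 0)
        ≤ c + (if k ∈ X then (univ.filter fun j => Q j ≠ []).card else 0) := by
      intro k
      by_cases hk : k ∈ X
      · have h3 := hQ.card_nbrsIn_add_le (hXQ k hk)
        have h4 : (headNbrs G u Q k).card ≤ (univ.filter fun j => Q j ≠ []).card :=
          card_le_card fun j hj => mem_filter.2 ⟨mem_univ _, ne_nil_of_mem_headNbrs hj⟩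
        simp only [hXQ k hk, hk, ne_eq, not_true_eq_false, if_false, if_true] at h3 h4 ⊢
        omega
      · have h3 := hXd k hk
        by_cases hQk : Q k = []
        · simpa [hQk, hk] using h3
        · have h4 := (hQ.card_nbrsIn_lt hu hS hux hQk).2
          rw [if_pos hQk, if_neg hk]
          rcases X.eq_empty_or_nonempty with hXe | hXn
          · rw [hXe, card_empty]; omega
          · have h5 : 2 * (Q k).length ≤ c := by
              by_contra h
              exact hfar ⟨hXn, k, by omega⟩
            have h6 := h4 h5
            omega
    have hsum := sum_le_sum fun k (_ : k ∈ (univ : Finset (ZMod c))) => hpt k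
    simp only [sum_add_distrib, sum_const, card_univ, ZMod.card, ← sum_filter, smul_eq_mul,
      mul_one, filter_mem_eq_inter, univ_inter] at hsum
    have hsum2 := sum_le_sum fun k (_ : k ∈ (univ : Finset (ZMod c))) => hdeg k
    rw [sum_add_distrib, sum_const, card_univ, ZMod.card, smul_eq_mul] at hsum2
    obtain ⟨k₀, hk₀⟩ : ∃ k, k ∉ X := by
      by_contra h
      push Not at h
      have h3 : X.card = c := by rw [eq_univ_iff_forall.2 h, card_univ, ZMod.card]
      omega
    refine mul_le_of_dist (by omega) (hZN k₀ hk₀) ?_ h2 ?_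
    · obtain ⟨e, he⟩ : ∃ e, G.minDegree = c + e := ⟨G.minDegree - c, by omega⟩
      rw [he] at hsum2
      rw [hN, he, show c + e - c + 1 = e + 1 by omega]
      nlinarith
    · intro k l hkl p hp p' hp' hpp
      have := hd k l hkl p hp p' hp' hpp
      omega

/-! ### From circumferences to rings, and the degenerate cases. -/

section circumference
variable {V : Type*} {G : SimpleGraph V}

theorem IsCycleOfLength.le_natCard [Finite V] {C : G.Subgraph} {n : ℕ}
    (h : IsCycleOfLength G C n) : n ≤ Nat.card V := by
  obtain ⟨hn, u, hu, -⟩ := h.exists_isRing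
  have := Nat.card_le_card_of_injective u hu.inj
  rwa [Nat.card_zmod] at this

theorem IsCycleOfLength.le_circumference [Finite V] {C : G.Subgraph} {n : ℕ}
    (h : IsCycleOfLength G C n) : n ≤ circumference G :=
  le_csSup ⟨Nat.card V, by rintro m ⟨D, hD⟩; exact hD.le_natCard⟩ ⟨C, h⟩

theorem exists_isCycleOfLength_circumference [Finite V] (h : circumference G ≠ 0) :
    ∃ C : G.Subgraph, IsCycleOfLength G C (circumference G) := by
  have hne : {n : ℕ | ∃ C : G.Subgraph, IsCycleOfLength G C n}.Nonempty := by
    rw [Set.nonempty_iff_ne_empty]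
    intro he
    exact h (by rw [circumference, he]; simp)
  exact Nat.sSup_mem hne ⟨Nat.card V, by rintro m ⟨D, hD⟩; exact hD.le_natCard⟩

theorem cycleBound_circumference_induce [Finite V] (S : Set V) :
    CycleBound G S (circumference (G.induce S)) := by
  rintro a l ⟨hn, hc⟩ hS
  obtain ⟨l', rfl⟩ : ∃ l' : List S, l'.map (↑) = l :=
    ⟨l.attachWith _ fun v hv => hS v (List.mem_cons_of_mem _ hv), by simp⟩
  obtain ⟨a', rfl⟩ : ∃ a' : S, (a' : V) = a := ⟨⟨a, hS a (by simp)⟩, rfl⟩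
  have hcc : ClosedChain (G.induce S) a' l' := by
    constructor
    · rw [← List.map_cons] at hn
      exact hn.of_map _
    · have : ((a' :: (l' ++ [a'])).map ((↑) : S → V)).IsChain G.Adj := by simpa using hc
      rw [List.isChain_map] at this
      exact this.imp fun _ _ h => h
  obtain ⟨D, hD, -⟩ := hcc.exists_isCycleOfLength
  simpa using hD.le_circumference

theorem circumference_eq_natCard [Finite V] [Nonempty V] (h : ∀ v w, v ≠ w → G.Adj v w) :
    circumference G = Nat.card V := by
  have := Fintype.ofFinite V
  have hlen : (univ : Finset V).toList.length = Nat.card V := by simp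
  have hle : Nat.card V ≤ circumference G := by
    match hl : (univ : Finset V).toList with
    | [] => simp [univ_eq_empty_iff] at hl
    | [a] =>
      rw [← hlen, hl]
      exact (IsCycleOfLength.vertex a).le_circumference
    | a :: b :: l =>
      have hn : (a :: b :: l).Nodup := hl ▸ nodup_toList _
      have hcc : ClosedChain G a (b :: l) := by
        rw [closedChain_iff]
        refine ⟨hn, List.Pairwise.isChain (hn.imp fun h' => h _ _ h'), h _ _ ?_⟩
        rw [List.getLast_cons (by simp)]
        exact fun e => (List.nodup_cons.1 hn).1 (e ▸ List.getLast_mem _)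
      obtain ⟨D, hD, -⟩ := hcc.exists_isCycleOfLength
      rw [← hlen, hl]
      exact hD.le_circumference
  refine le_antisymm ?_ hle
  have hpos : 0 < Nat.card V := Nat.card_pos
  obtain ⟨C, hC⟩ := exists_isCycleOfLength_circumference (G := G) (by omega)
  exact hC.le_natCard

theorem IsLongestCycle.circumference_bound {V : Type*} [Fintype V] {G : SimpleGraph V}
    [DecidableRel G.Adj] {C : G.Subgraph} {n : ℕ} (h : IsLongestCycle G C n) :
    ((circumference (removeSubgraph G C) : ℤ) + 1) *
      ((G.minDegree : ℤ) - (circumference (removeSubgraph G C) : ℤ) + 1) ≤ (n : ℤ) := by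
  have hG : CycleBound G Set.univ n := by
    intro a l hcc _
    obtain ⟨D, hD, -⟩ := hcc.exists_isCycleOfLength
    exact h.2 D _ hD
  obtain ⟨hn, x, hx, hxC⟩ := h.1.exists_isRing
  have : NeZero n := ⟨hn.ne'⟩
  have : Nonempty V := ⟨x 0⟩
  have hδ := hG.minDegree_lt hn
  have hS := cycleBound_circumference_induce (G := G) C.vertsᶜ
  change CycleBound G C.vertsᶜ (circumference (removeSubgraph G C)) at hS
  set c := circumference (removeSubgraph G C) with hc
  rcases Nat.eq_zero_or_pos c with hc0 | hcpos
  · rw [hc0]; push_cast; omega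
  rcases Nat.lt_or_ge c G.minDegree with hlt | hge
  · have : NeZero c := ⟨hcpos.ne'⟩
    obtain ⟨D, hD⟩ := exists_isCycleOfLength_circumference
      (G := removeSubgraph G C) (hc ▸ hcpos.ne')
    rw [← hc] at hD
    obtain ⟨-, u, hu, -⟩ := hD.exists_isRing
    rw [← hxC] at hS
    have hu' : IsRing G fun i => (u i : V) :=
      ⟨Subtype.val_injective.comp hu.inj, fun h2 i => hu.adj h2 i⟩
    have hux : Set.range (fun i => (u i : V)) ⊆ (Set.range x)ᶜ := by
      rintro _ ⟨i, rfl⟩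
      rw [hxC]
      exact (u i).2
    have key := mul_le_of_longest hx hu' hux hG hS hlt
    zify at key
    rw [Nat.cast_sub hlt.le] at key
    exact key
  · rcases hge.eq_or_lt with heq | hgt
    · rw [heq]
      have : (c : ℤ) + 1 ≤ n := by exact_mod_cast heq ▸ hδ
      nlinarith
    · have h1 : (G.minDegree : ℤ) - c + 1 ≤ 0 := by omega
      nlinarith

end circumference

/-! ### Sharpness: the join graphs. -/

section joinGraph
variable {r m k : ℕ}

theorem joinGraph_adj_inr {x : (Fin r × Fin m) ⊕ Fin k} {b : Fin k} :
    (joinGraph r m k).Adj x (Sum.inr b) ↔ x ≠ Sum.inr b :=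
  ⟨fun h => h.1, fun h => ⟨h, fun _ _ _ _ _ h' => by cases h'⟩⟩

theorem joinGraph_adj_inl {i j : Fin r} {a b : Fin m} :
    (joinGraph r m k).Adj (Sum.inl (i, a)) (Sum.inl (j, b)) ↔ i = j ∧ a ≠ b := by
  constructor
  · rintro ⟨h1, h2⟩
    have := h2 i j a b rfl rfl
    subst this
    exact ⟨rfl, fun e => h1 (e ▸ rfl)⟩
  · rintro ⟨rfl, h⟩
    refine ⟨by simpa using h, ?_⟩
    intro i' j' a' b' h1 h2
    cases h1; cases h2; rfl

theorem degree_joinGraph_inl (i : Fin r) (a : Fin m) :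
    (joinGraph r m k).degree (Sum.inl (i, a)) = m - 1 + k := by
  have h : (joinGraph r m k).neighborFinset (Sum.inl (i, a))
      = ((univ.erase a).map ⟨fun b => (i, b), Prod.mk_right_injective i⟩).disjSum univ := by
    ext y
    rw [mem_neighborFinset]
    rcases y with ⟨j, b⟩ | b
    · rw [joinGraph_adj_inl]
      simp only [inl_mem_disjSum, mem_map, mem_erase, mem_univ, and_true,
        Function.Embedding.coeFn_mk, Prod.mk.injEq]
      constructor
      · rintro ⟨rfl, h⟩; exact ⟨b, h.symm, rfl, rfl⟩
      · rintro ⟨_, h, rfl, rfl⟩; exact ⟨rfl, h.symm⟩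
    · rw [joinGraph_adj_inr]; simp
  rw [← card_neighborFinset_eq_degree, h, card_disjSum, card_map, card_erase_of_mem (mem_univ a)]
  simp

theorem degree_joinGraph_inr (b : Fin k) :
    (joinGraph r m k).degree (Sum.inr b) = r * m + k - 1 := by
  have h : (joinGraph r m k).neighborFinset (Sum.inr b) = univ.erase (Sum.inr b) := by
    ext y
    rw [mem_neighborFinset, adj_comm, joinGraph_adj_inr]; simp
  rw [← card_neighborFinset_eq_degree, h, card_erase_of_mem (mem_univ _)]
  simp

theorem minDegree_joinGraph (hm : 0 < m) (hr : 0 < r) :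
    (joinGraph r m k).minDegree = m - 1 + k := by
  have : Nonempty ((Fin r × Fin m) ⊕ Fin k) := ⟨Sum.inl (⟨0, hr⟩, ⟨0, hm⟩)⟩
  refine le_antisymm ?_ ?_
  · rw [← degree_joinGraph_inl (r := r) (k := k) ⟨0, hr⟩ ⟨0, hm⟩]
    exact minDegree_le_degree _ _
  · refine le_minDegree_of_forall_le_degree _ _ fun v => ?_
    rcases v with ⟨i, a⟩ | b
    · rw [degree_joinGraph_inl]
    · rw [degree_joinGraph_inr]
      have := Nat.le_mul_of_pos_left m hr
      have := b.pos
      omega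

/-- A cycle of `r K_m + K_k` has at most `k (m + 1)` vertices. -/
theorem IsCycleOfLength.le_of_joinGraph (hk : 0 < k) {C : (joinGraph r m k).Subgraph} {n : ℕ}
    (h : IsCycleOfLength (joinGraph r m k) C n) : n ≤ k * (m + 1) := by
  classical
  obtain ⟨hn, y, hy, -⟩ := h.exists_isRing
  have : NeZero n := ⟨hn.ne'⟩
  by_cases hone : ∃ i, ∀ p, ∃ a, y p = Sum.inl (i, a)
  · obtain ⟨i, hi⟩ := hone
    choose a ha using hi
    have hinj : Function.Injective a := by
      intro p q hpq
      exact hy.inj (by rw [ha, ha, hpq])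
    have := Fintype.card_le_of_injective a hinj
    rw [ZMod.card, Fintype.card_fin] at this
    calc n ≤ 1 * (m + 1) := by omega
      _ ≤ _ := Nat.mul_le_mul_right _ hk
  · set I := univ.filter fun i => ∃ p a, y p = Sum.inl (i, a) with hI
    set B := univ.filter fun b => ∃ p, y p = Sum.inr b with hB
    -- A cycle not contained in copy `i` must leave it, and the only way out is a vertex of `K_k`.
    -- Its predecessor on the cycle determines the copy, so at most `k` copies are visited.
    have hexit : ∀ i ∈ I, ∃ b, ∃ p, (∃ a, y p = Sum.inl (i, a)) ∧ y (p + 1) = Sum.inr b := by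
      intro i hi
      obtain ⟨p, a, hpa⟩ := (mem_filter.1 hi).2
      by_contra hcon
      push Not at hcon
      have hall : ∀ t : ℕ, ∃ a, y (p + (t : ZMod n)) = Sum.inl (i, a) := by
        intro t
        induction t with
        | zero => exact ⟨a, by simpa using hpa⟩
        | succ t ih =>
          obtain ⟨a', ha'⟩ := ih
          push_cast
          rw [← add_assoc]
          rcases Nat.lt_or_ge n 2 with h2 | h2
          · obtain rfl : n = 1 := by omega
            exact ⟨a', by rw [← ha']; congr 1; exact Subsingleton.elim _ _⟩
          have hadj := hy.adj h2 (p + (t : ZMod n))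
          rcases hq : y (p + (t : ZMod n) + 1) with ⟨j, b⟩ | b
          · rw [ha', hq, joinGraph_adj_inl] at hadj
            exact ⟨b, by rw [hadj.1]⟩
          · exact absurd hq (hcon b _ ⟨a', ha'⟩)
      refine hone ⟨i, fun q => ?_⟩
      obtain ⟨a', ha'⟩ := hall (q - p).val
      rw [ZMod.add_val_sub] at ha'
      exact ⟨a', ha'⟩
    have : Nonempty (Fin k) := ⟨⟨0, hk⟩⟩
    choose! f hf using hexit
    have hIB : I.card ≤ B.card := by
      refine card_le_card_of_injOn f ?_ ?_
      · intro i hi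
        obtain ⟨p, -, hp⟩ := hf i hi
        exact mem_filter.2 ⟨mem_univ _, _, hp⟩
      · intro i hi j hj hij
        obtain ⟨p, ⟨a, ha⟩, hp⟩ := hf i hi
        obtain ⟨q, ⟨b, hb⟩, hq⟩ := hf j hj
        have hpq : p = q := add_right_cancel (hy.inj (hp.trans (hij ▸ hq.symm)))
        subst hpq
        have := ha.symm.trans hb
        simp only [Sum.inl.injEq, Prod.mk.injEq] at this
        exact this.1
    have hBk : B.card ≤ k := by simpa using card_le_univ B
    have hcov : univ.image y ⊆ (I ×ˢ (univ : Finset (Fin m))).disjSum B := by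
      intro v hv
      obtain ⟨p, -, rfl⟩ := mem_image.1 hv
      rcases hp : y p with ⟨i, a⟩ | b
      · simp only [inl_mem_disjSum, mem_product, mem_univ, and_true]
        exact mem_filter.2 ⟨mem_univ _, p, a, hp⟩
      · simp only [inr_mem_disjSum]
        exact mem_filter.2 ⟨mem_univ _, p, hp⟩
    have hcard := card_le_card hcov
    rw [card_image_of_injective _ hy.inj, card_univ, ZMod.card, card_disjSum, card_product,
      card_univ, Fintype.card_fin] at hcard
    have := Nat.mul_le_mul_right m (hIB.trans hBk)
    linarith

/-- The position of the `t`-th vertex of the `j`-th block of a longest cycle of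
`(k + 1) K_m + K_k`; a block consists of a vertex of `K_k`, followed by a copy of `K_m`. -/
def blockVertex (m k : ℕ) (p : Fin k × Fin (m + 1)) : (Fin (k + 1) × Fin m) ⊕ Fin k :=
  Fin.cases (Sum.inr p.1) (fun a => Sum.inl (p.1.castSucc, a)) p.2

theorem blockVertex_injective : Function.Injective (blockVertex m k) := by
  rintro ⟨i, s⟩ ⟨j, t⟩ h
  induction s using Fin.cases <;> induction t using Fin.cases <;> simp_all [blockVertex]

theorem compl_range_blockVertex :
    (Set.range (blockVertex m k))ᶜ = Set.range fun a : Fin m => Sum.inl (Fin.last k, a) := by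
  ext v
  simp only [Set.mem_compl_iff, Set.mem_range, not_exists]
  constructor
  · intro h
    rcases v with ⟨i, a⟩ | b
    · induction i using Fin.lastCases with
      | last => exact ⟨a, rfl⟩
      | cast i => exact absurd rfl (h (i, a.succ))
    · exact absurd rfl (h (b, 0))
  · rintro ⟨a, rfl⟩ ⟨i, s⟩ h
    induction s using Fin.cases with
    | zero => simp [blockVertex] at h
    | succ s =>
      simp only [blockVertex, Fin.cases_succ, Sum.inl.injEq, Prod.mk.injEq] at h
      exact absurd h.1 (Fin.castSucc_lt_last i).ne

theorem joinGraph_adj_blockVertex {p q : Fin k × Fin (m + 1)} (hpq : p ≠ q)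
    (h : p.2 ≠ 0 → q.2 ≠ 0 → p.1 = q.1) :
    (joinGraph (k + 1) m k).Adj (blockVertex m k p) (blockVertex m k q) := by
  refine ⟨fun e => hpq (blockVertex_injective e), ?_⟩
  obtain ⟨i, s⟩ := p
  obtain ⟨j, t⟩ := q
  induction s using Fin.cases with
  | zero => intro i' j' a b h1; simp [blockVertex] at h1
  | succ s =>
    induction t using Fin.cases with
    | zero => intro i' j' a b _ h2; simp [blockVertex] at h2
    | succ t =>
      intro i' j' a b h1 h2
      have hij := h (Fin.succ_ne_zero _) (Fin.succ_ne_zero _)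
      simp only [blockVertex, Fin.cases_succ, Sum.inl.injEq, Prod.mk.injEq] at h1 h2
      rw [← h1.1, ← h2.1, show i = j from hij]

theorem exists_cycle_of_fin {V : Type*} {G : SimpleGraph V} {M : ℕ} {f : Fin (M + 1) → V}
    (hf : Function.Injective f) (hstep : ∀ p : Fin M, G.Adj (f p.castSucc) (f p.succ))
    (hclose : G.Adj (f (Fin.last M)) (f 0)) :
    ∃ C : G.Subgraph, IsCycleOfLength G C (M + 1) ∧ C.verts = Set.range f := by
  have hl : f 0 :: (List.finRange M).map (fun p => f p.succ) = (List.finRange (M + 1)).map f := by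
    rw [List.finRange_succ]; simp
  have hcc : ClosedChain G (f 0) ((List.finRange M).map fun p => f p.succ) := by
    rw [closedChain_iff]
    simp only [hl]
    refine ⟨(List.nodup_finRange _).map hf, ?_, ?_⟩
    · rw [List.isChain_iff_getElem]
      intro i hi
      simp only [List.length_map, List.length_finRange] at hi
      simp only [List.getElem_map, List.getElem_finRange]
      exact hstep ⟨i, by omega⟩
    · simpa [List.finRange_succ_last] using hclose
  obtain ⟨D, hD, hDv⟩ := hcc.exists_isCycleOfLength
  refine ⟨D, by simpa using hD, ?_⟩
  rw [hDv, hl]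
  ext v
  simp

/-- Concatenate the `k` blocks. Position `p` is in block `p / (m + 1)`, and this quotient changes
only on arriving at remainder 0, a vertex of `K_k`, which is adjacent to everything else. -/
theorem exists_cycle_joinGraph (hm : 0 < m) (hk : 0 < k) :
    ∃ C : (joinGraph (k + 1) m k).Subgraph,
      IsCycleOfLength (joinGraph (k + 1) m k) C (k * (m + 1)) ∧
        C.verts = Set.range (blockVertex m k) := by
  have hN2 : 2 ≤ k * (m + 1) := by nlinarith
  obtain ⟨M, hM⟩ : ∃ M, k * (m + 1) = M + 1 := ⟨k * (m + 1) - 1, by omega⟩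
  let e : Fin (M + 1) ≃ Fin k × Fin (m + 1) := (finCongr hM.symm).trans finProdFinEquiv.symm
  have he1 : ∀ p, ((e p).1 : ℕ) = p / (m + 1) := fun p => rfl
  have he2 : ∀ p, ((e p).2 : ℕ) = p % (m + 1) := fun p => rfl
  rw [hM]
  obtain ⟨C, hC, hCv⟩ := exists_cycle_of_fin (G := joinGraph (k + 1) m k)
    (f := blockVertex m k ∘ e) (blockVertex_injective.comp e.injective)
    (fun p => by
      refine joinGraph_adj_blockVertex (fun h => ?_) (fun _ h => ?_)
      · exact Fin.castSucc_lt_succ.ne (e.injective h)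
      · refine Fin.ext ?_
        rw [he1, he1]
        have h2 : (p.succ : ℕ) % (m + 1) ≠ 0 := fun h' => h (Fin.ext (by rw [he2, h']; rfl))
        simp only [Fin.val_succ, Fin.val_castSucc] at h2 ⊢
        rw [Nat.succ_div, if_neg (fun hd => h2 (Nat.mod_eq_zero_of_dvd hd)), add_zero])
    (by
      refine joinGraph_adj_blockVertex (fun h => ?_) (fun _ h => ?_)
      · have := congrArg Fin.val (e.injective h)
        simp at this; omega
      · exact absurd (Fin.ext (by rw [he2]; simp)) h)
  exact ⟨C, hC, by rw [hCv, e.surjective.range_comp]⟩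

theorem circumference_removeSubgraph_joinGraph (hm : 0 < m)
    {C : (joinGraph (k + 1) m k).Subgraph} (hC : C.verts = Set.range (blockVertex m k)) :
    circumference (removeSubgraph (joinGraph (k + 1) m k) C) = m := by
  have hcompl : C.vertsᶜ = Set.range fun a : Fin m => Sum.inl (Fin.last k, a) := by
    rw [hC, compl_range_blockVertex]
  have hcard : Nat.card ↥(C.vertsᶜ) = m := by
    rw [hcompl, Nat.card_range_of_injective, Nat.card_fin]
    intro a b h
    simpa using h
  have : Nonempty ↥(C.vertsᶜ) := by
    rw [← Finite.card_pos_iff, hcard]; exact hm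
  rw [circumference_eq_natCard, hcard]
  rintro ⟨v, hv⟩ ⟨w, hw⟩ hne
  rw [hcompl] at hv hw
  obtain ⟨a, rfl⟩ := hv
  obtain ⟨b, rfl⟩ := hw
  rw [comap_adj]
  exact joinGraph_adj_inl.2 ⟨rfl, fun h => hne (by subst h; rfl)⟩

end joinGraph

theorem theorem2 :
    (∀ (V : Type*) [Fintype V] (G : SimpleGraph V) [DecidableRel G.Adj]
        (C : G.Subgraph) (n : ℕ), IsLongestCycle G C n →
      ((circumference (removeSubgraph G C) : ℤ) + 1) *
          ((G.minDegree : ℤ) - (circumference (removeSubgraph G C) : ℤ) + 1) ≤ (n : ℤ)) ∧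
    (∀ δ κ : ℕ, 1 ≤ κ → κ ≤ δ →
      (joinGraph (κ + 1) (δ - κ + 1) κ).minDegree = δ ∧
      ∃ (C : (joinGraph (κ + 1) (δ - κ + 1) κ).Subgraph) (n : ℕ),
        IsLongestCycle (joinGraph (κ + 1) (δ - κ + 1) κ) C n ∧
        circumference (removeSubgraph (joinGraph (κ + 1) (δ - κ + 1) κ) C) = δ - κ + 1 ∧
        (n : ℤ) =
          ((circumference (removeSubgraph (joinGraph (κ + 1) (δ - κ + 1) κ) C) : ℤ) + 1) *
            ((δ : ℤ) -
              (circumference (removeSubgraph (joinGraph (κ + 1) (δ - κ + 1) κ) C) : ℤ) + 1)) := by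
  refine ⟨fun V _ G _ C n h => h.circumference_bound, fun δ κ hκ hκδ => ⟨?_, ?_⟩⟩
  · rw [minDegree_joinGraph (by omega) (by omega)]; omega
  · obtain ⟨C, hC, hCv⟩ := exists_cycle_joinGraph (m := δ - κ + 1) (k := κ) (by omega) hκ
    have hc := circumference_removeSubgraph_joinGraph (by omega) hCv
    refine ⟨C, _, ⟨hC, fun D n hD => hD.le_of_joinGraph hκ⟩, hc, ?_⟩
    rw [hc]
    push_cast [hκδ]
    ring
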